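/- Conventions. A computable metric space is a separable metric space $(X,d)$ with a dense sequence $(s_i)_{i\in\mathbb N}$ of "ideal" points such that the real numbers $d(s_i,s_j)$ are computable uniformly in $(i,j)$. An ideal ball is a ball $B(s_i,q)$ with $q>0$ rational. A point $x\in X$ is computable if there is a computable $f:\mathbb N\to\mathbb N$ with $d(s_{f(n)},x)<2^{-n}$ for all $n$. A map $f:X\to X'$ of computable metric spaces is computable if the preimage of each ideal ball of $X'$ is the union of a recursively enumerable family of ideal balls of $X$, uniformly in the ball. For compact $X$, a Borel probability measure $\mu$ on $X$ is computable if there is an algorithm which on input $n$ outputs a finite convex rational combination $\mu_n$ of Dirac measures at ideal points with $W_1(\mu_n,\mu)<2^{-n}$, where $W_1(\mu,\nu)=\sup\{|\int f\,d\mu-\int f\,d\nu| : f \text{ is } 1\text{-Lipschitz}\}$. The circle $S^1=\mathbb R/\mathbb Z$ carries the arc length distance and the rational points as ideal points; the torus $S^1\times S^1$ carries the maximum distance and the pairs of ideal points. Invariant measures are Borel probability measures, and a measure of maximal entropy of $T$ is an invariant measure $\mu$ with $h_\mu(T)=h_{\mathrm{top}}(T)$. Theorem. There exist a computable map $T_1:S^1\to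 S^1$ and a closed set $K\subset S^1$ containing no computable point such that every $T_1$-invariant measure has its support in $K$ and is non-computable, and such that, with $T_2:S^1\to S^1$, $T_2(x)=2x \bmod \mathbb Z$, the map $$T=T_1\times T_2:S^1\times S^1\to S^1\times S^1$$ has the following properties: (a) $T$ is a computable map; (b) $h_{\mathrm{top}}(T)=\log 2$, and $T$ has a measure of maximal entropy; indeed, for every $T_1$-invariant measure $\nu$ and the Lebesgue measure $\lambda$ on $S^1$, the product $\nu\times\lambda$ is $T$-invariant with $h_{\nu\times\lambda}(T)=h_{\mathrm{top}}(T)=\log 2$; (c) every $T$-invariant measure is non-computable; in particular, every measure of maximal entropy of $T$ is non-computable. -/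

import Mathlib

open MeasureTheory Filter Topology
open scoped ENNReal

noncomputable section

/-! ### Computable rationals and reals -/

/-- The effective numbering `(a, b, c) ↦ (a - b) / (c + 1)` of the rational numbers. -/
def ratOfCode (c : ℕ × ℕ × ℕ) : ℚ := ((c.1 : ℚ) - c.2.1) / (c.2.2 + 1)

/-- A function into the rationals is computable if codes of its values can be computed. -/
def ComputableRat {α : Type*} [Primcodable α] (f : α → ℚ) : Prop :=
  ∃ c : α → ℕ × ℕ × ℕ, Computable c ∧ ∀ a, f a = ratOfCode (c a)

/-- The real numbers `x a` are computable, uniformly in `a`. -/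
def UniformlyComputableReal {α : Type*} [Primcodable α] (x : α → ℝ) : Prop :=
  ∃ f : α × ℕ → ℚ, ComputableRat f ∧ ∀ a n, |(f (a, n) : ℝ) - x a| < (2 : ℝ)⁻¹ ^ n

/-! ### Computable metric spaces -/

/-- A computable metric space: a metric space with a dense sequence of ideal points whose mutual
distances are uniformly computable real numbers. -/
class ComputableMetricSpace (X : Type*) [MetricSpace X] where
  ideal : ℕ → X
  dense_ideal : DenseRange ideal
  dist_ideal : UniformlyComputableReal (fun p : ℕ × ℕ => dist (ideal p.1) (ideal p.2))

/-- The computable points of a space `M` with distance `d` and ideal points `s i`, `i : I`. -/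
def IsComputablePointWith {M I : Type*} [Primcodable I] (d : M → M → ℝ) (s : I → M) (x : M) :
    Prop :=
  ∃ f : ℕ → I, Computable f ∧ ∀ n, d (s (f n)) x < (2 : ℝ)⁻¹ ^ n

/-- Computable points of a computable metric space. -/
def IsComputablePoint {X : Type*} [MetricSpace X] [ComputableMetricSpace X] (x : X) : Prop :=
  IsComputablePointWith dist (ComputableMetricSpace.ideal (X := X)) x

/-- The ideal ball with code `(i, k, m)`: its centre is the `i`-th ideal point and its radius is
the positive rational `(k + 1) / (m + 1)`. -/
def idealBall (X : Type*) [MetricSpace X] [ComputableMetricSpace X] (b : ℕ × ℕ × ℕ) : Set X :=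
  Metric.ball (ComputableMetricSpace.ideal b.1) (((b.2.1 : ℝ) + 1) / ((b.2.2 : ℝ) + 1))

/-- The sets `U a` are lower-computable open, uniformly in `a`: each of them is the union of the
ideal balls in a uniformly recursively enumerable (possibly empty) family. -/
def UniformlyLowerComputableOpen {X : Type*} [MetricSpace X] [ComputableMetricSpace X]
    {α : Type*} [Primcodable α] (U : α → Set X) : Prop :=
  ∃ E : α × (ℕ × ℕ × ℕ) → Prop, REPred E ∧
    ∀ a, U a = ⋃ (b : ℕ × ℕ × ℕ) (_ : E (a, b)), idealBall X b

/-- Computable functions between computable metric spaces: the preimages of ideal balls are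
lower-computable open sets, uniformly in the ball. -/
def IsComputableMap {X Y : Type*} [MetricSpace X] [ComputableMetricSpace X]
    [MetricSpace Y] [ComputableMetricSpace Y] (f : X → Y) : Prop :=
  UniformlyLowerComputableOpen (fun b : ℕ × ℕ × ℕ => f ⁻¹' idealBall Y b)

/-! ### Products and the circle as computable metric spaces -/

/-- The code of the larger of two coded rationals. -/
def maxCode (p : (ℕ × ℕ × ℕ) × (ℕ × ℕ × ℕ)) : ℕ × ℕ × ℕ :=
  if p.1.1 * (p.2.2.2 + 1) + p.2.2.1 * (p.1.2.2 + 1) ≤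
      p.2.1 * (p.1.2.2 + 1) + p.1.2.1 * (p.2.2.2 + 1) then p.2 else p.1

theorem ratOfCode_maxCode (c d : ℕ × ℕ × ℕ) :
    ratOfCode (maxCode (c, d)) = max (ratOfCode c) (ratOfCode d) := by
  have key : ratOfCode c ≤ ratOfCode d ↔ c.1 * (d.2.2 + 1) + d.2.1 * (c.2.2 + 1) ≤
      d.1 * (c.2.2 + 1) + c.2.1 * (d.2.2 + 1) := by
    unfold ratOfCode
    rw [div_le_div_iff₀ (by positivity) (by positivity), ← @Nat.cast_le ℚ]
    push_cast
    constructor <;> intro h <;> linarith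
  unfold maxCode
  split_ifs with h
  · exact (max_eq_right (key.2 h)).symm
  · exact (max_eq_left (le_of_lt (not_le.1 (fun h' => h (key.1 h'))))).symm

theorem primrec_maxCode : Primrec maxCode := by
  have a1 : Primrec (fun p : (ℕ × ℕ × ℕ) × (ℕ × ℕ × ℕ) => p.1.1) :=
    Primrec.fst.comp Primrec.fst
  have a2 : Primrec (fun p : (ℕ × ℕ × ℕ) × (ℕ × ℕ × ℕ) => p.1.2.1) :=
    Primrec.fst.comp (Primrec.snd.comp Primrec.fst)
  have a3 : Primrec (fun p : (ℕ × ℕ × ℕ) × (ℕ × ℕ × ℕ) => p.1.2.2 + 1) :=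
    Primrec.succ.comp (Primrec.snd.comp (Primrec.snd.comp Primrec.fst))
  have b1 : Primrec (fun p : (ℕ × ℕ × ℕ) × (ℕ × ℕ × ℕ) => p.2.1) :=
    Primrec.fst.comp Primrec.snd
  have b2 : Primrec (fun p : (ℕ × ℕ × ℕ) × (ℕ × ℕ × ℕ) => p.2.2.1) :=
    Primrec.fst.comp (Primrec.snd.comp Primrec.snd)
  have b3 : Primrec (fun p : (ℕ × ℕ × ℕ) × (ℕ × ℕ × ℕ) => p.2.2.2 + 1) :=
    Primrec.succ.comp (Primrec.snd.comp (Primrec.snd.comp Primrec.snd))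
  exact Primrec.ite (Primrec.nat_le.comp
    (Primrec.nat_add.comp (Primrec.nat_mul.comp a1 b3) (Primrec.nat_mul.comp b2 a3))
    (Primrec.nat_add.comp (Primrec.nat_mul.comp b1 a3) (Primrec.nat_mul.comp a2 b3)))
    Primrec.snd Primrec.fst

/-- The product of two computable metric spaces, with the maximum distance and with the pairs of
ideal points as ideal points. -/
instance {X Y : Type*} [MetricSpace X] [ComputableMetricSpace X] [MetricSpace Y]
    [ComputableMetricSpace Y] : ComputableMetricSpace (X × Y) where
  ideal n := (ComputableMetricSpace.ideal n.unpair.1, ComputableMetricSpace.ideal n.unpair.2)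
  dense_ideal := by
    have h := (ComputableMetricSpace.dense_ideal (X := X)).prodMap
      (ComputableMetricSpace.dense_ideal (X := Y))
    have hs : Function.Surjective Nat.unpair := Nat.surjective_unpair
    have h2 := h.comp hs.denseRange (by fun_prop)
    exact h2
  dist_ideal := by
    obtain ⟨f, ⟨c, hc, hfc⟩, hf⟩ := ComputableMetricSpace.dist_ideal (X := X)
    obtain ⟨g, ⟨d, hd, hgd⟩, hg⟩ := ComputableMetricSpace.dist_ideal (X := Y)
    have u1 : Computable (fun q : (ℕ × ℕ) × ℕ =>
        (((q.1.1.unpair.1, q.1.2.unpair.1), q.2) : (ℕ × ℕ) × ℕ)) :=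
      (((Computable.fst.comp (Computable.unpair.comp (Computable.fst.comp Computable.fst))).pair
        (Computable.fst.comp (Computable.unpair.comp (Computable.snd.comp Computable.fst)))).pair
        Computable.snd)
    have u2 : Computable (fun q : (ℕ × ℕ) × ℕ =>
        (((q.1.1.unpair.2, q.1.2.unpair.2), q.2) : (ℕ × ℕ) × ℕ)) :=
      (((Computable.snd.comp (Computable.unpair.comp (Computable.fst.comp Computable.fst))).pair
        (Computable.snd.comp (Computable.unpair.comp (Computable.snd.comp Computable.fst)))).pair
        Computable.snd)
    refine ⟨fun q => max (f ((q.1.1.unpair.1, q.1.2.unpair.1), q.2))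
      (g ((q.1.1.unpair.2, q.1.2.unpair.2), q.2)),
      ⟨_, primrec_maxCode.to_comp.comp ((hc.comp u1).pair (hd.comp u2)), fun q => ?_⟩,
      fun a n => ?_⟩
    · beta_reduce
      rw [hfc, hgd]
      exact (ratOfCode_maxCode _ _).symm
    · beta_reduce
      rw [Prod.dist_eq, Rat.cast_max]
      refine lt_of_le_of_lt (abs_max_sub_max_le_max _ _ _ _) (max_lt ?_ ?_)
      · exact hf (a.1.unpair.1, a.2.unpair.1) n
      · exact hg (a.1.unpair.2, a.2.unpair.2) n

/-- The code of the distance on `ℝ/ℤ` between the rational points `a / (b + 1)` and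
`c / (d + 1)`. -/
def circleDistCode (p : (ℕ × ℕ) × (ℕ × ℕ)) : ℕ × ℕ × ℕ :=
  (min ((p.1.1 * (p.2.2 + 1) + p.2.1 * (p.1.2 + 1) * ((p.1.2 + 1) * (p.2.2 + 1) - 1)) %
        ((p.1.2 + 1) * (p.2.2 + 1)))
      ((p.1.2 + 1) * (p.2.2 + 1) -
        (p.1.1 * (p.2.2 + 1) + p.2.1 * (p.1.2 + 1) * ((p.1.2 + 1) * (p.2.2 + 1) - 1)) %
        ((p.1.2 + 1) * (p.2.2 + 1))),
    0, (p.1.2 + 1) * (p.2.2 + 1) - 1)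

theorem primrec_circleDistCode : Primrec circleDistCode := by
  have a1 : Primrec (fun p : (ℕ × ℕ) × (ℕ × ℕ) => p.1.1) := Primrec.fst.comp Primrec.fst
  have a2 : Primrec (fun p : (ℕ × ℕ) × (ℕ × ℕ) => p.1.2 + 1) :=
    Primrec.succ.comp (Primrec.snd.comp Primrec.fst)
  have b1 : Primrec (fun p : (ℕ × ℕ) × (ℕ × ℕ) => p.2.1) := Primrec.fst.comp Primrec.snd
  have b2 : Primrec (fun p : (ℕ × ℕ) × (ℕ × ℕ) => p.2.2 + 1) :=
    Primrec.succ.comp (Primrec.snd.comp Primrec.snd)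
  have m := Primrec.nat_mul.comp a2 b2
  have m1 := Primrec.nat_sub.comp m (Primrec.const 1)
  have r := Primrec.nat_mod.comp (Primrec.nat_add.comp (Primrec.nat_mul.comp a1 b2)
    (Primrec.nat_mul.comp (Primrec.nat_mul.comp b1 a2) m1)) m
  exact (Primrec.nat_min.comp r (Primrec.nat_sub.comp m r)).pair
    ((Primrec.const 0).pair m1)

theorem ratOfCode_circleDistCode (a b c d : ℕ) :
    (ratOfCode (circleDistCode ((a, b), (c, d))) : ℝ) =
      dist (((a : ℝ) / (b + 1) : ℝ) : UnitAddCircle) (((c : ℝ) / (d + 1) : ℝ) : UnitAddCircle) := by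
  obtain ⟨m, hm⟩ : ∃ m, (b + 1) * (d + 1) = m + 1 := ⟨(b + 1) * (d + 1) - 1, by
    have : 0 < (b + 1) * (d + 1) := by positivity
    omega⟩
  set r : ℕ := a * (d + 1) + c * (b + 1) * m with hr
  have hmR : ((b : ℝ) + 1) * (d + 1) = m + 1 := by exact_mod_cast hm
  have hb : (b : ℝ) + 1 ≠ 0 := by positivity
  have hd : (d : ℝ) + 1 ≠ 0 := by positivity
  have hreal : (a : ℝ) / (b + 1) - c / (d + 1) =
      ((r : ℝ) / ((m + 1 : ℕ) : ℝ)) * 1 - ((c * (b + 1) : ℕ) : ℝ) := by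
    have hmm : ((m : ℝ) + 1) ≠ 0 := by positivity
    have e : (r : ℝ) = a * (d + 1) + c * (b + 1) * m := by rw [hr]; push_cast; ring
    have e2 : (a : ℝ) / (b + 1) - c / (d + 1) =
        (a * (d + 1) - c * (b + 1)) / (((b : ℝ) + 1) * (d + 1)) := by
      field_simp
    rw [e2, hmR, e]
    push_cast
    field_simp
    ring
  have hn : (((c * (b + 1) : ℕ) : ℝ) : UnitAddCircle) = 0 := by
    have h := (AddCircle.coe_eq_zero_iff (1 : ℝ)
      (x := ((c * (b + 1) : ℕ) : ℝ))).2 ⟨((c * (b + 1) : ℕ) : ℤ), by simp⟩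
    exact h
  rw [dist_eq_norm, ← AddCircle.coe_sub, hreal, AddCircle.coe_sub, hn, sub_zero,
    AddCircle.norm_div_natCast]
  unfold circleDistCode ratOfCode
  simp only [hm, Nat.add_sub_cancel]
  push_cast [← hr]
  simp

/-- The circle `ℝ/ℤ` with its arc length distance and with the rational points as ideal points. -/
instance : ComputableMetricSpace UnitAddCircle where
  ideal n := (((n.unpair.1 : ℝ) / (n.unpair.2 + 1) : ℝ) : UnitAddCircle)
  dense_ideal := by
    have h1 : DenseRange (fun q : ℚ => ((q : ℝ) : UnitAddCircle)) :=
      (QuotientAddGroup.mk_surjective.denseRange).comp Rat.denseRange_cast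
        (AddCircle.continuous_mk' 1)
    refine h1.mono ?_
    rintro _ ⟨q, rfl⟩
    refine ⟨Nat.pair (q.num % q.den).toNat (q.den - 1), ?_⟩
    have hden : (0 : ℤ) < q.den := by exact_mod_cast q.pos
    have h0 : 0 ≤ q.num % q.den := Int.emod_nonneg _ hden.ne'
    have hc : (((q.num % q.den).toNat : ℕ) : ℝ) = ((q.num % q.den : ℤ) : ℝ) := by
      have : (((q.num % q.den).toNat : ℕ) : ℤ) = q.num % q.den := Int.toNat_of_nonneg h0
      exact_mod_cast this
    have hd : ((q.den - 1 : ℕ) : ℝ) + 1 = q.den := by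
      have : q.den - 1 + 1 = q.den := Nat.sub_add_cancel q.pos
      exact_mod_cast this
    simp only [Nat.unpair_pair]
    rw [hc, hd]
    have hdR : (q.den : ℝ) ≠ 0 := by exact_mod_cast q.den_nz
    have hq : (q : ℝ) = ((q.num % q.den : ℤ) : ℝ) / q.den + ((q.num / q.den : ℤ) : ℝ) := by
      have e : ((q.num % q.den : ℤ) : ℝ) + (q.den : ℝ) * ((q.num / q.den : ℤ) : ℝ) = q.num := by
        exact_mod_cast Int.emod_add_mul_ediv q.num q.den
      have e3 : (q : ℝ) = q.num / q.den := Rat.cast_def q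
      rw [e3, ← e]
      field_simp
    have hz : (((q.num / q.den : ℤ) : ℝ) : UnitAddCircle) = 0 :=
      (AddCircle.coe_eq_zero_iff (1 : ℝ)).2 ⟨q.num / q.den, by simp⟩
    rw [hq, AddCircle.coe_add, hz, add_zero]
  dist_ideal := by
    refine ⟨fun q => ratOfCode (circleDistCode (q.1.1.unpair, q.1.2.unpair)),
      ⟨_, primrec_circleDistCode.to_comp.comp
        ((Computable.unpair.comp (Computable.fst.comp Computable.fst)).pair
          (Computable.unpair.comp (Computable.snd.comp Computable.fst))), fun q => rfl⟩,
      fun a n => ?_⟩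
    have h := ratOfCode_circleDistCode a.1.unpair.1 a.1.unpair.2 a.2.unpair.1 a.2.unpair.2
    simp only [Prod.mk.eta] at h
    rw [h, sub_self, abs_zero]
    positivity

/-! ### Computable probability measures -/

/-- The unnormalized sum of the point masses `w + 1` at the `i`-th ideal points, `(w, i) ∈ L`. -/
def idealSum (X : Type*) [MetricSpace X] [ComputableMetricSpace X] [MeasurableSpace X]
    (L : List (ℕ × ℕ)) : Measure X :=
  (L.map fun a => ((a.1 : ℝ≥0∞) + 1) •
    Measure.dirac (ComputableMetricSpace.ideal a.2 : X)).sum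

theorem idealSum_univ (X : Type*) [MetricSpace X] [ComputableMetricSpace X] [MeasurableSpace X]
    (L : List (ℕ × ℕ)) :
    idealSum X L Set.univ = (L.map fun a => ((a.1 : ℝ≥0∞) + 1)).sum := by
  unfold idealSum
  induction L with
  | nil => simp
  | cons a L ih => simp [ih]

/-- The finite convex rational combinations of Dirac measures at ideal points: a nonempty list of
pairs `(w, i)` (given by its head and its tail) codes the measure `∑ (w + 1) δ_{s_i}`, divided by
its total mass `∑ (w + 1)`. -/
def idealMeasure (X : Type*) [MetricSpace X] [ComputableMetricSpace X] [MeasurableSpace X]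
    (p : (ℕ × ℕ) × List (ℕ × ℕ)) : ProbabilityMeasure X :=
  ⟨((((p.1 :: p.2).map fun a => ((a.1 : ℝ≥0∞) + 1)).sum)⁻¹) • idealSum X (p.1 :: p.2), ⟨by
    have hfin : ∀ L : List (ℕ × ℕ), (L.map fun a => ((a.1 : ℝ≥0∞) + 1)).sum ≠ ⊤ := by
      intro L
      induction L with
      | nil => simp
      | cons a L ih =>
        rw [List.map_cons, List.sum_cons]
        exact ENNReal.add_ne_top.2 ⟨by simp, ih⟩
    rw [Measure.smul_apply, idealSum_univ, smul_eq_mul]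
    exact ENNReal.inv_mul_cancel (by simp) (hfin _)⟩⟩

/-- The Wasserstein–Kantorovich distance of two probability measures on a compact metric space. -/
def wassersteinDist {X : Type*} [MetricSpace X] [CompactSpace X] [MeasurableSpace X]
    (μ ν : ProbabilityMeasure X) : ℝ :=
  ⨆ f : {f : X → ℝ // LipschitzWith 1 f},
    |(∫ x, f.1 x ∂(μ : Measure X)) - ∫ x, f.1 x ∂(ν : Measure X)|

/-- Computable probability measures on a compact computable metric space: the computable points of
the space of probability measures with the Wasserstein–Kantorovich distance and with the finite
convex rational combinations of Dirac measures at ideal points as ideal points. -/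
def IsComputableMeasure {X : Type*} [MetricSpace X] [CompactSpace X] [ComputableMetricSpace X]
    [MeasurableSpace X] (μ : ProbabilityMeasure X) : Prop :=
  IsComputablePointWith wassersteinDist (idealMeasure X) μ

/-! ### Entropy -/

/-- The Shannon entropy `-∑ μ(A_i) log μ(A_i)` of the finite partition into the fibres
`A_i = P ⁻¹' {i}`. -/
def partitionEntropy {X ι : Type*} [MeasurableSpace X] [Fintype ι] (μ : Measure X) (P : X → ι) :
    ℝ :=
  ∑ i, Real.negMulLog (μ.real (P ⁻¹' {i}))

/-- The join of the partitions `P`, `T⁻¹ P`, …, `T⁻⁽ⁿ⁻¹⁾ P`. -/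
def iteratedJoin {X ι : Type*} (T : X → X) (P : X → ι) (n : ℕ) : X → (Fin n → ι) :=
  fun x j => P (T^[j] x)

/-- The entropy `lim (1/n) H(P ∨ T⁻¹ P ∨ … ∨ T⁻⁽ⁿ⁻¹⁾ P)` of `T` relative to the partition `P`
(the limit exists when `μ` is invariant). -/
def entropyOfPartition {X ι : Type*} [MeasurableSpace X] [Fintype ι] (T : X → X) (μ : Measure X)
    (P : X → ι) : EReal :=
  limsup (fun n : ℕ => ((partitionEntropy μ (iteratedJoin T P n) / n : ℝ) : EReal)) atTop

/-- The measure-theoretic (Kolmogorov–Sinai) entropy: the supremum over the finite measurable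
partitions of the entropy relative to the partition. -/
def measureEntropy {X : Type*} [MeasurableSpace X] (T : X → X) (μ : Measure X) : EReal :=
  ⨆ (k : ℕ) (P : X → Fin k) (_ : Measurable P), entropyOfPartition T μ P

/-- The topological entropy of a map of a compact space. -/
def topologicalEntropy {X : Type*} [UniformSpace X] (T : X → X) : EReal :=
  Dynamics.coverEntropy T Set.univ

/-- `μ` is a `T`-invariant Borel probability measure. -/
def IsInvariantProbability {X : Type*} [MeasurableSpace X] (T : X → X) (μ : Measure X) : Prop :=
  IsProbabilityMeasure μ ∧ MeasurePreserving T μ μ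

/-- `μ` is a measure of maximal entropy of `T`. -/
def IsMeasureOfMaximalEntropy {X : Type*} [UniformSpace X] [MeasurableSpace X] (T : X → X)
    (μ : Measure X) : Prop :=
  IsInvariantProbability T μ ∧ measureEntropy T μ = topologicalEntropy T

/-- The doubling map `x ↦ 2x mod ℤ` of the circle `ℝ/ℤ`. -/
def doublingMap (x : UnitAddCircle) : UnitAddCircle := 2 • x

end

/-! ### Shannon entropy of finite partitions -/

/-! The map `T₁` is a drift x ↦ x + g(x), where the speed g ≥ 0 is positive exactly on a recursively
enumerable union U of balls, and K is the set of rest points g = 0. Two properties of U are needed: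
its complement is nonempty, and every computable measure charges it.

U comes from a diagonalisation over all programs (`heavyArc`). Put k = e + 4. If program e outputs a
code for a finite measure on input 2k + 1, then by pigeonhole one of the 2^k arcs of length 2^(-k)
carries at least the average weight, and the ball of radius 2·2^(-k) about its left endpoint goes
into U. These balls have total length at most 1/2, so K is nonempty (`exists_speed_eq_zero`). A
measure that does not charge the ball is at Wasserstein distance at least 2^(-2k) from the coded
one, which is seen by testing against a tent function on the ball; so program e cannot approximate
it to precision 2^(-(2k+1)) (`IsComputableMeasure.not_ae_speed_eq_zero`).

The speed is 1/2-Lipschitz, so no orbit jumps over a rest point a. Cutting the circle at a yields a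
bounded coordinate that increases by exactly g at each step; integrating against an invariant
measure gives ∫ g = 0 (`ae_eq_zero_of_invariant_driftMap`). Thus invariant measures live on K and
are not computable. Dirac measures at points of K are invariant, and a computable point has a
computable Dirac measure, so K has no computable point. On the torus, the first marginal of an
invariant measure is `T₁`-invariant, and marginals of computable measures are computable
(`IsComputableMeasure.map_fst`).

For the entropy, the arc itineraries of a drift cut at a are monotone, hence polynomially many,
while dyadic itineraries of the doubling map number O(2^n). This one count
(`itineraryGrowthLE_driftMap_prod`) bounds both the topological and the measure entropy by log 2.
The lower bounds come from the doubling factor alone: binary itineraries have Lebesgue measure at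
most 2^(-n), and the points j / 2^n are separated.

Computability of the maps reduces to being 2-Lipschitz and computable at ideal points
(`ComputableOnIdeal.isComputableMap`). -/

theorem negMulLog_sum_le {ι : Type*} (s : Finset ι) {p : ι → ℝ} (hp : ∀ i ∈ s, 0 ≤ p i) :
    Real.negMulLog (∑ i ∈ s, p i) ≤ ∑ i ∈ s, Real.negMulLog (p i) := by
  have h : Real.negMulLog (∑ i ∈ s, p i) = ∑ i ∈ s, -p i * Real.log (∑ j ∈ s, p j) := by
    rw [Real.negMulLog, ← Finset.sum_mul, Finset.sum_neg_distrib]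
  rw [h]
  refine Finset.sum_le_sum fun i hi => ?_
  rcases (hp i hi).eq_or_lt with h0 | h0
  · simp [← h0]
  · have hle : p i ≤ ∑ j ∈ s, p j := Finset.single_le_sum hp hi
    have := Real.log_le_log h0 hle
    rw [Real.negMulLog]
    nlinarith

/-- Gibbs' inequality. -/
theorem sum_negMulLog_le {ι : Type*} [Fintype ι] {p q : ι → ℝ} (hp : ∀ i, 0 ≤ p i)
    (hq : ∀ i, 0 ≤ q i) (hpq : ∀ i, q i = 0 → p i = 0) (h : ∑ i, q i ≤ ∑ i, p i) :
    ∑ i, Real.negMulLog (p i) ≤ ∑ i, -(p i * Real.log (q i)) := by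
  have key : ∀ i, Real.negMulLog (p i) ≤ -(p i * Real.log (q i)) + (q i - p i) := by
    intro i
    rcases (hp i).eq_or_lt with h0 | h0
    · simpa [← h0] using hq i
    · have hq0 : 0 < q i := (hq i).lt_of_ne fun h' => h0.ne' (hpq i h'.symm)
      -- The inequality log t ≤ t - 1 at t = q i / p i; the error terms q i - p i have nonpositive
      -- sum by `h`.
      have h1 := Real.log_le_sub_one_of_pos (div_pos hq0 h0)
      rw [Real.log_div hq0.ne' h0.ne'] at h1
      have h2 := mul_le_mul_of_nonneg_left h1 h0.le
      have h3 : p i * (q i / p i - 1) = q i - p i := by field_simp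
      rw [h3] at h2
      rw [Real.negMulLog]
      linarith
  calc ∑ i, Real.negMulLog (p i) ≤ ∑ i, (-(p i * Real.log (q i)) + (q i - p i)) :=
        Finset.sum_le_sum fun i _ => key i
    _ ≤ _ := by
        rw [Finset.sum_add_distrib, Finset.sum_sub_distrib]
        linarith

section Partitions

variable {X ι κ : Type*} [MeasurableSpace X] {μ : Measure X}

theorem measurableSet_preimage_of_fibres [Fintype ι] {A : X → ι} (hA : ∀ i, MeasurableSet (A ⁻¹' {i}))
    (s : Set ι) : MeasurableSet (A ⁻¹' s) := by
  rw [← Set.biUnion_preimage_singleton]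
  exact MeasurableSet.biUnion (Set.to_countable s) fun i _ => hA i

theorem measureReal_preimage_comp [Fintype ι] [IsProbabilityMeasure μ] [DecidableEq κ] {A : X → ι}
    (hA : ∀ i, MeasurableSet (A ⁻¹' {i})) (f : ι → κ) (k : κ) :
    μ.real ((fun x => f (A x)) ⁻¹' {k}) = ∑ i with f i = k, μ.real (A ⁻¹' {i}) := by
  have h : (fun x => f (A x)) ⁻¹' {k} = ⋃ i ∈ Finset.univ.filter (fun i => f i = k), A ⁻¹' {i} := by
    ext x
    simp
  rw [h, measureReal_biUnion_finset]
  · intro i _ j _ hij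
    exact Disjoint.preimage A (by simpa using hij)
  · exact fun i _ => hA i

theorem sum_measureReal_fibres [Fintype ι] [IsProbabilityMeasure μ] {A : X → ι}
    (hA : ∀ i, MeasurableSet (A ⁻¹' {i})) : ∑ i, μ.real (A ⁻¹' {i}) = 1 := by
  have h := measureReal_preimage_comp (μ := μ) hA (fun _ => ()) ()
  simpa using h.symm

/-- Merging atoms cannot raise entropy: group the atoms by their image under `f` and use
subadditivity of `Real.negMulLog` in each group. -/
theorem partitionEntropy_comp_le [Fintype ι] [Fintype κ] [IsProbabilityMeasure μ] {A : X → ι}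
    (hA : ∀ i, MeasurableSet (A ⁻¹' {i})) (f : ι → κ) :
    partitionEntropy μ (fun x => f (A x)) ≤ partitionEntropy μ A := by
  classical
  unfold partitionEntropy
  rw [← Finset.sum_fiberwise Finset.univ f]
  refine Finset.sum_le_sum fun k _ => ?_
  rw [measureReal_preimage_comp hA]
  exact negMulLog_sum_le _ fun i _ => measureReal_nonneg

/-- Gibbs' inequality, comparing the joint distribution with the product of its marginals. -/
theorem partitionEntropy_prodMk_le [Fintype ι] [Fintype κ] [IsProbabilityMeasure μ] {A : X → ι} {B : X → κ}
    (hA : ∀ i, MeasurableSet (A ⁻¹' {i})) (hB : ∀ i, MeasurableSet (B ⁻¹' {i})) :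
    partitionEntropy μ (fun x => (A x, B x)) ≤ partitionEntropy μ A + partitionEntropy μ B := by
  classical
  set C : X → ι × κ := fun x => (A x, B x) with hC
  have hCm : ∀ p, MeasurableSet (C ⁻¹' {p}) := by
    rintro ⟨i, j⟩
    have : C ⁻¹' {(i, j)} = A ⁻¹' {i} ∩ B ⁻¹' {j} := by ext x; simp [hC]
    rw [this]
    exact (hA i).inter (hB j)
  have hp1 : ∀ i, μ.real (A ⁻¹' {i}) = ∑ j, μ.real (C ⁻¹' {(i, j)}) := by
    intro i
    have h := measureReal_preimage_comp (μ := μ) hCm Prod.fst i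
    rw [show (fun x => (C x).1) = A from rfl] at h
    rw [h]
    refine Finset.sum_bij' (fun p _ => p.2) (fun j _ => (i, j)) ?_ ?_ ?_ ?_ ?_ <;>
      aesop
  have hp2 : ∀ j, μ.real (B ⁻¹' {j}) = ∑ i, μ.real (C ⁻¹' {(i, j)}) := by
    intro j
    have h := measureReal_preimage_comp (μ := μ) hCm Prod.snd j
    rw [show (fun x => (C x).2) = B from rfl] at h
    rw [h]
    refine Finset.sum_bij' (fun p _ => p.1) (fun i _ => (i, j)) ?_ ?_ ?_ ?_ ?_ <;>
      aesop
  have hle1 : ∀ p, μ.real (C ⁻¹' {p}) ≤ μ.real (A ⁻¹' {p.1}) := fun p =>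
    measureReal_mono (fun x hx => by simp [hC] at hx ⊢; rw [← hx])
  have hle2 : ∀ p, μ.real (C ⁻¹' {p}) ≤ μ.real (B ⁻¹' {p.2}) := fun p =>
    measureReal_mono (fun x hx => by simp [hC] at hx ⊢; rw [← hx])
  have hz1 : ∀ p, μ.real (A ⁻¹' {p.1}) = 0 → μ.real (C ⁻¹' {p}) = 0 := fun p h =>
    le_antisymm ((hle1 p).trans h.le) measureReal_nonneg
  have hz2 : ∀ p, μ.real (B ⁻¹' {p.2}) = 0 → μ.real (C ⁻¹' {p}) = 0 := fun p h =>
    le_antisymm ((hle2 p).trans h.le) measureReal_nonneg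
  have hg := sum_negMulLog_le (p := fun p => μ.real (C ⁻¹' {p}))
    (q := fun p => μ.real (A ⁻¹' {p.1}) * μ.real (B ⁻¹' {p.2}))
    (fun _ => measureReal_nonneg) (fun _ => mul_nonneg measureReal_nonneg measureReal_nonneg)
    (fun p h => (mul_eq_zero.1 h).elim (hz1 p) (hz2 p))
    (by
      rw [sum_measureReal_fibres hCm, Fintype.sum_prod_type]
      dsimp only
      rw [← Finset.sum_mul_sum, sum_measureReal_fibres hA, sum_measureReal_fibres hB, one_mul])
  refine hg.trans (le_of_eq ?_)
  have hsplit : ∀ p, -(μ.real (C ⁻¹' {p}) *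
      Real.log (μ.real (A ⁻¹' {p.1}) * μ.real (B ⁻¹' {p.2}))) =
      -(μ.real (C ⁻¹' {p}) * Real.log (μ.real (A ⁻¹' {p.1}))) +
      -(μ.real (C ⁻¹' {p}) * Real.log (μ.real (B ⁻¹' {p.2}))) := by
    intro p
    by_cases h1 : μ.real (A ⁻¹' {p.1}) = 0
    · simp [hz1 p h1]
    by_cases h2 : μ.real (B ⁻¹' {p.2}) = 0
    · simp [hz2 p h2]
    rw [Real.log_mul h1 h2]
    ring
  rw [Finset.sum_congr rfl fun p _ => hsplit p, Finset.sum_add_distrib]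
  congr 1
  · rw [Fintype.sum_prod_type]
    refine Finset.sum_congr rfl fun i _ => ?_
    dsimp only
    rw [Finset.sum_neg_distrib, ← Finset.sum_mul, ← hp1, Real.negMulLog, neg_mul]
  · rw [Fintype.sum_prod_type_right]
    refine Finset.sum_congr rfl fun j _ => ?_
    dsimp only
    rw [Finset.sum_neg_distrib, ← Finset.sum_mul, ← hp2, Real.negMulLog, neg_mul]

/-- Gibbs' inequality against the uniform distribution on the values actually taken. Counting only
these, and not all of `ι`, is what lets itinerary counts control entropy. -/
theorem partitionEntropy_le_log_ncard [Fintype ι] [IsProbabilityMeasure μ] {A : X → ι}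
    (hA : ∀ i, MeasurableSet (A ⁻¹' {i})) :
    partitionEntropy μ A ≤ Real.log (Set.range A).ncard := by
  classical
  have hne : (Set.range A).Nonempty := by
    obtain ⟨x⟩ : Nonempty X := nonempty_of_isProbabilityMeasure μ
    exact ⟨A x, x, rfl⟩
  have hM : 0 < ((Set.range A).ncard : ℝ) := by
    exact_mod_cast (Set.ncard_pos (Set.toFinite _)).2 hne
  have hg := sum_negMulLog_le (p := fun i => μ.real (A ⁻¹' {i}))
    (q := fun i => if i ∈ Set.range A then ((Set.range A).ncard : ℝ)⁻¹ else 0)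
    (fun _ => measureReal_nonneg) (fun i => by positivity)
    (fun i h => by
      have hi : i ∉ Set.range A := fun h' => by
        rw [if_pos h'] at h
        exact (inv_pos.2 hM).ne' h
      rw [Set.preimage_singleton_eq_empty.2 hi, measureReal_empty])
    (by
      have hf : (Finset.univ.filter fun i => i ∈ Set.range A).card = (Set.range A).ncard := by
        rw [← Set.ncard_coe_finset]
        congr 1
        ext
        simp
      rw [sum_measureReal_fibres hA, ← Finset.sum_filter, Finset.sum_const, nsmul_eq_mul, hf]
      exact (mul_inv_cancel₀ hM.ne').le)
  refine hg.trans (le_of_eq ?_)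
  have : ∀ i, -(μ.real (A ⁻¹' {i}) *
      Real.log (if i ∈ Set.range A then ((Set.range A).ncard : ℝ)⁻¹ else 0)) =
      μ.real (A ⁻¹' {i}) * Real.log (Set.range A).ncard := by
    intro i
    split_ifs with hi
    · rw [Real.log_inv]; ring
    · rw [Set.preimage_singleton_eq_empty.2 hi, measureReal_empty]; simp
  rw [Finset.sum_congr rfl fun i _ => this i, ← Finset.sum_mul, sum_measureReal_fibres hA, one_mul]

theorem measurableSet_iteratedJoin_fibre {T : X → X} (hT : Measurable T) {A : X → ι}
    (hA : ∀ i, MeasurableSet (A ⁻¹' {i})) (n : ℕ) (v : Fin n → ι) :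
    MeasurableSet (iteratedJoin T A n ⁻¹' {v}) := by
  have : iteratedJoin T A n ⁻¹' {v} = ⋂ j : Fin n, T^[j] ⁻¹' (A ⁻¹' {v j}) := by
    ext x
    simp [iteratedJoin, funext_iff]
  rw [this]
  exact MeasurableSet.iInter fun j => (hT.iterate j) (hA _)

/-- Split off the last letter of the itinerary: subadditivity applies, and by invariance each letter
has the entropy of `A`. -/
theorem partitionEntropy_iteratedJoin_le [Fintype ι] [IsProbabilityMeasure μ] {T : X → X}
    (hT : MeasurePreserving T μ μ) {A : X → ι} (hA : ∀ i, MeasurableSet (A ⁻¹' {i})) (n : ℕ) :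
    partitionEntropy μ (iteratedJoin T A n) ≤ n * partitionEntropy μ A := by
  induction n with
  | zero =>
    refine (partitionEntropy_le_log_ncard
      (measurableSet_iteratedJoin_fibre hT.measurable hA 0)).trans ?_
    have : (Set.range (iteratedJoin T A 0)).ncard ≤ 1 := Set.ncard_le_one_of_subsingleton _
    simpa using Real.log_nonpos (Nat.cast_nonneg _) (by exact_mod_cast this)
  | succ n ih =>
    have hTn := hT.iterate n
    have hm : ∀ i, MeasurableSet ((fun x => A (T^[n] x)) ⁻¹' {i}) := fun i =>
      hTn.measurable (hA i)
    have h1 : iteratedJoin T A (n + 1) =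
        fun x => (fun p : (Fin n → ι) × ι => Fin.snoc (α := fun _ => ι) p.1 p.2)
          (iteratedJoin T A n x, A (T^[n] x)) := by
      funext x
      exact (Fin.snoc_init_self (iteratedJoin T A (n + 1) x)).symm
    have h2 : partitionEntropy μ (fun x => A (T^[n] x)) = partitionEntropy μ A := by
      unfold partitionEntropy
      refine Finset.sum_congr rfl fun i _ => ?_
      rw [show (fun x => A (T^[n] x)) ⁻¹' {i} = T^[n] ⁻¹' (A ⁻¹' {i}) from rfl,
        hTn.measureReal_preimage (hA i).nullMeasurableSet]
    have hjm := measurableSet_iteratedJoin_fibre hT.measurable hA n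
    have hpm : ∀ p, MeasurableSet ((fun x => (iteratedJoin T A n x, A (T^[n] x))) ⁻¹' {p}) := by
      rintro ⟨v, i⟩
      have : (fun x => (iteratedJoin T A n x, A (T^[n] x))) ⁻¹' {(v, i)} =
        iteratedJoin T A n ⁻¹' {v} ∩ (fun x => A (T^[n] x)) ⁻¹' {i} := by ext x; simp
      rw [this]
      exact (hjm v).inter (hm i)
    have h3 := partitionEntropy_comp_le (μ := μ) hpm
      (fun p => Fin.snoc (α := fun _ => ι) p.1 p.2)
    rw [← h1] at h3
    refine h3.trans ((partitionEntropy_prodMk_le hjm hm).trans ?_)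
    rw [h2]
    push_cast
    linarith

end Partitions

/-! ### Entropy bounds from the growth of itineraries -/

/-- There are arbitrarily fine finite measurable partitions whose number of itineraries of length
`n` is at most `C (n + 1) ^ d b ^ n`. -/
def ItineraryGrowthLE {X : Type*} [PseudoMetricSpace X] [MeasurableSpace X] (T : X → X)
    (b : ℕ) : Prop :=
  ∀ ε > 0, ∃ (ι : Type) (_ : Fintype ι) (Q : X → ι), (∀ i, MeasurableSet (Q ⁻¹' {i})) ∧
    (∀ x y, Q x = Q y → dist x y < ε) ∧
    ∃ C d : ℕ, ∀ n, (Set.range (iteratedJoin T Q n)).ncard ≤ C * (n + 1) ^ d * b ^ n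

theorem tendsto_log_poly_mul_pow_div {C d b : ℕ} (hC : 0 < C) (hb : 0 < b) :
    Tendsto (fun n : ℕ => Real.log ((C * (n + 1) ^ d * b ^ n : ℕ) : ℝ) / n) atTop
      (𝓝 (Real.log b)) := by
  have h0 : Tendsto (fun n : ℕ => Real.log ((n : ℝ) + 1) / n) atTop (𝓝 0) := by
    have h1 : Tendsto (fun n : ℕ => Real.log (((n + 1 : ℕ)) : ℝ) / ((n + 1 : ℕ) : ℝ)) atTop (𝓝 0) :=
      (Real.isLittleO_log_id_atTop.tendsto_div_nhds_zero).comp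
        (tendsto_natCast_atTop_atTop.comp (tendsto_add_atTop_nat 1))
    have h2 : Tendsto (fun n : ℕ => (1 : ℝ) + 1 / n) atTop (𝓝 (1 + 0)) :=
      tendsto_const_nhds.add tendsto_one_div_atTop_nhds_zero_nat
    have h3 := h1.mul h2
    rw [zero_mul] at h3
    refine h3.congr' ?_
    filter_upwards [eventually_gt_atTop 0] with n hn
    have : (n : ℝ) ≠ 0 := by exact_mod_cast hn.ne'
    push_cast
    field_simp
  have h1 : Tendsto (fun n : ℕ => Real.log C * (1 / (n : ℝ)) + d * (Real.log ((n : ℝ) + 1) / n) +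
      Real.log b) atTop (𝓝 (Real.log C * 0 + d * 0 + Real.log b)) :=
    ((tendsto_one_div_atTop_nhds_zero_nat.const_mul _).add (h0.const_mul _)).add_const _
  simp only [mul_zero, zero_add] at h1
  refine h1.congr' ?_
  filter_upwards [eventually_gt_atTop 0] with n hn
  have hn' : (n : ℝ) ≠ 0 := by exact_mod_cast hn.ne'
  have hC' : (C : ℝ) ≠ 0 := by exact_mod_cast hC.ne'
  have hb' : (b : ℝ) ≠ 0 := by exact_mod_cast hb.ne'
  have hn1 : (n : ℝ) + 1 ≠ 0 := by positivity
  push_cast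
  rw [Real.log_mul (by positivity) (by positivity), Real.log_mul hC' (by positivity),
    Real.log_pow, Real.log_pow]
  field_simp

/-- A finite measurable partition is approximated by functions of any sufficiently fine partition. -/
theorem exists_approx_of_fine {X ι : Type*} [MetricSpace X] [CompactSpace X] [MeasurableSpace X]
    [BorelSpace X] [Fintype ι] (μ : Measure X) [IsProbabilityMeasure μ] {P : X → ι}
    (hP : ∀ i, MeasurableSet (P ⁻¹' {i})) {δ : ℝ} (hδ : 0 < δ) :
    ∃ ε > 0, ∀ (κ : Type) (Q : X → κ), (∀ x y, Q x = Q y → dist x y < ε) →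
      ∃ f : κ → ι, μ.real {x | P x ≠ f (Q x)} < δ := by
  classical
  -- The extra 1 makes the final sum of `δ / N` over `ι` strictly smaller than `δ`.
  set N : ℝ := Fintype.card ι + 1 with hN
  have hN0 : 0 < N := by positivity
  -- Inner regularity: each atom is replaced by a closed core. Disjoint compact cores are a positive
  -- distance apart, so a fine atom of `Q` meets at most one of them.
  have hF : ∀ i, ∃ F ⊆ P ⁻¹' {i}, IsClosed F ∧ μ (P ⁻¹' {i} \ F) < ENNReal.ofReal (δ / N) :=
    fun i => (hP i).exists_isClosed_sdiff_lt (measure_ne_top _ _)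
      (ENNReal.ofReal_pos.2 (div_pos hδ hN0)).ne'
  choose F hFs hFc hFμ using hF
  have hsep : ∀ p : ι × ι, ∀ᶠ ε : ℝ in 𝓝[>] 0, p.1 ≠ p.2 →
      ∀ x ∈ F p.1, ∀ y ∈ F p.2, ¬ dist x y < ε := by
    rintro ⟨i, j⟩
    by_cases hij : i = j
    · exact Eventually.of_forall fun _ h => (h hij).elim
    · have hd : Disjoint (F i) (F j) :=
        (Disjoint.preimage P (by simpa using hij : Disjoint {i} {j})).mono (hFs i) (hFs j)
      obtain ⟨ε, hε, hdis⟩ := hd.exists_thickenings (hFc i).isCompact (hFc j)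
      filter_upwards [Ioo_mem_nhdsGT hε] with e he _ x hx y hy hxy
      exact Set.disjoint_left.1 hdis (Metric.self_subset_thickening hε _ hx)
        (Metric.mem_thickening_iff.2 ⟨y, hy, hxy.trans he.2⟩)
  obtain ⟨ε, hε, hε0⟩ := ((eventually_all.2 hsep).and self_mem_nhdsWithin).exists
  refine ⟨ε, hε0, fun κ Q hQ => ?_⟩
  obtain ⟨x₀⟩ : Nonempty X := nonempty_of_isProbabilityMeasure μ
  -- An atom of `Q` that meets a core receives the label of that core; the label of the others is
  -- irrelevant, since their points lie in the small exceptional set.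
  set f : κ → ι := fun q => if h : ∃ x, x ∈ F (P x) ∧ Q x = q then P h.choose else P x₀ with hf
  refine ⟨f, ?_⟩
  have hsub : {x | P x ≠ f (Q x)} ⊆ ⋃ i ∈ (Finset.univ : Finset ι), (P ⁻¹' {i} \ F i) := by
    intro x hx
    simp only [Finset.mem_univ, Set.iUnion_true, Set.mem_iUnion]
    refine ⟨P x, rfl, fun hxF => hx ?_⟩
    have h : ∃ y, y ∈ F (P y) ∧ Q y = Q x := ⟨x, hxF, rfl⟩
    simp only [hf, dif_pos h]
    by_contra hne
    exact hε (P x, P h.choose) hne x hxF _ h.choose_spec.1 (hQ _ _ h.choose_spec.2.symm)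
  calc μ.real {x | P x ≠ f (Q x)} ≤ μ.real (⋃ i ∈ (Finset.univ : Finset ι), (P ⁻¹' {i} \ F i)) :=
        measureReal_mono hsub (measure_ne_top _ _)
    _ ≤ ∑ i, μ.real (P ⁻¹' {i} \ F i) := measureReal_biUnion_finset_le _ _
    _ ≤ ∑ _i : ι, δ / N := Finset.sum_le_sum fun i _ =>
        ENNReal.toReal_le_of_le_ofReal (div_pos hδ hN0).le (hFμ i).le
    _ < δ := by
        rw [Finset.sum_const, nsmul_eq_mul, Finset.card_univ, ← mul_div_assoc, div_lt_iff₀ hN0, hN]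
        nlinarith

/-- A partition one of whose atoms has almost full measure has small entropy. -/
theorem exists_partitionEntropy_le {X : Type*} (ι : Type*) [MeasurableSpace X] [Fintype ι]
    (μ : Measure X) [IsProbabilityMeasure μ] {η : ℝ} (hη : 0 < η) :
    ∃ δ > 0, ∀ E : X → Option ι, (∀ i, MeasurableSet (E ⁻¹' {i})) →
      μ.real {x | E x ≠ none} < δ → partitionEntropy μ E ≤ η := by
  set N : ℝ := (Fintype.card (Option ι) : ℝ) with hN
  have hN0 : 0 < N := by rw [hN]; exact_mod_cast Fintype.card_pos
  -- Used at the two zeros of `Real.negMulLog`: the atom of `none` has mass near 1, all the others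
  -- have mass near 0.
  have hc : ∀ t : ℝ, Real.negMulLog t = 0 → ∃ δ > 0, ∀ s, |s - t| < δ → Real.negMulLog s ≤ η / N := by
    intro t ht
    obtain ⟨δ, hδ, h⟩ := Metric.continuousAt_iff.1 (Real.continuous_negMulLog.continuousAt (x := t))
      (η / N) (div_pos hη hN0)
    refine ⟨δ, hδ, fun s hs => ?_⟩
    have := h (x := s) (by rwa [Real.dist_eq])
    rw [ht, Real.dist_eq, sub_zero] at this
    exact (le_abs_self _).trans this.le
  obtain ⟨δ₀, hδ₀, h₀⟩ := hc 0 Real.negMulLog_zero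
  obtain ⟨δ₁, hδ₁, h₁⟩ := hc 1 Real.negMulLog_one
  refine ⟨min δ₀ δ₁, lt_min hδ₀ hδ₁, fun E hE hlt => ?_⟩
  have hterm : ∀ i, Real.negMulLog (μ.real (E ⁻¹' {i})) ≤ η / N := by
    intro i
    cases i with
    | none =>
      refine h₁ _ ?_
      have hcompl : {x | E x ≠ none} = (E ⁻¹' {none})ᶜ := rfl
      rw [hcompl, probReal_compl_eq_one_sub (hE none)] at hlt
      rw [abs_sub_comm, abs_of_nonneg (sub_nonneg.2 measureReal_le_one)]
      exact hlt.trans_le (min_le_right _ _)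
    | some i =>
      refine h₀ _ ?_
      rw [sub_zero, abs_of_nonneg measureReal_nonneg]
      refine lt_of_le_of_lt (measureReal_mono fun x hx => ?_) (hlt.trans_le (min_le_left _ _))
      have : E x = some i := hx
      simp [this]
  calc partitionEntropy μ E ≤ ∑ _i : Option ι, η / N := Finset.sum_le_sum fun i _ => hterm i
    _ = η := by
        rw [Finset.sum_const, nsmul_eq_mul, Finset.card_univ, ← hN]
        field_simp

/-- An arbitrary partition `P` agrees with a function of a fine `Q` off a small set. Let `E` record
the correct value where they disagree and `none` elsewhere. The `P`-itinerary is then a function of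
the `Q`- and `E`-itineraries, so its entropy is at most the logarithm of the number of
`Q`-itineraries plus n times the small entropy of `E`. -/
theorem measureEntropy_le_log {X : Type*} [MetricSpace X] [CompactSpace X] [MeasurableSpace X]
    [BorelSpace X] {T : X → X} {b : ℕ} (hb : 0 < b) (hT : ItineraryGrowthLE T b) {μ : Measure X}
    (hμ : IsInvariantProbability T μ) : measureEntropy T μ ≤ (Real.log b : EReal) := by
  classical
  obtain ⟨hprob, hinv⟩ := hμ
  refine iSup_le fun k => iSup_le fun P => iSup_le fun hPm => ?_
  have hP : ∀ i, MeasurableSet (P ⁻¹' {i}) := fun i => hPm (measurableSet_singleton i)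
  refine EReal.le_of_forall_lt_iff_le.1 fun z hz => ?_
  have hz' : Real.log b < z := by exact_mod_cast hz
  set η := (z - Real.log b) / 2 with hη
  have hη0 : 0 < η := by rw [hη]; linarith
  obtain ⟨δ, hδ, hE⟩ := exists_partitionEntropy_le (Fin k) μ hη0
  obtain ⟨ε, hε, happ⟩ := exists_approx_of_fine μ hP hδ
  obtain ⟨ι, _, Q, hQm, hQd, C, d, hcount⟩ := hT ε hε
  obtain ⟨f, hf⟩ := happ ι Q hQd
  set E : X → Option (Fin k) := fun x => if P x = f (Q x) then none else some (P x) with hEdef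
  have hQPm : ∀ p, MeasurableSet ((fun x => (Q x, P x)) ⁻¹' {p}) := by
    rintro ⟨q, p⟩
    have : (fun x => (Q x, P x)) ⁻¹' {(q, p)} = Q ⁻¹' {q} ∩ P ⁻¹' {p} := by ext x; simp
    rw [this]
    exact (hQm q).inter (hP p)
  have hEm : ∀ i, MeasurableSet (E ⁻¹' {i}) := fun i =>
    measurableSet_preimage_of_fibres hQPm
      ((fun q : ι × Fin k => if q.2 = f q.1 then none else some q.2) ⁻¹' {i})
  have hEη : partitionEntropy μ E ≤ η := by
    refine hE E hEm (lt_of_le_of_lt (measureReal_mono fun x hx => ?_) hf)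
    intro h
    exact hx (by simp [hEdef, h])
  have hC : 0 < C := by
    have h := hcount 0
    obtain ⟨x₀⟩ : Nonempty X := nonempty_of_isProbabilityMeasure μ
    have h1 : 0 < (Set.range (iteratedJoin T Q 0)).ncard :=
      (Set.ncard_pos (Set.toFinite _)).2 ⟨_, x₀, rfl⟩
    simp only [zero_add, one_pow, mul_one, pow_zero] at h
    omega
  have hbound : ∀ n : ℕ, partitionEntropy μ (iteratedJoin T P n) ≤
      Real.log ((C * (n + 1) ^ d * b ^ n : ℕ) : ℝ) + n * η := by
    intro n
    have hA := measurableSet_iteratedJoin_fibre hinv.measurable hQm n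
    have hB := measurableSet_iteratedJoin_fibre hinv.measurable hEm n
    have hAB : ∀ p, MeasurableSet
        ((fun x => (iteratedJoin T Q n x, iteratedJoin T E n x)) ⁻¹' {p}) := by
      rintro ⟨u, v⟩
      have : (fun x => (iteratedJoin T Q n x, iteratedJoin T E n x)) ⁻¹' {(u, v)} =
        iteratedJoin T Q n ⁻¹' {u} ∩ iteratedJoin T E n ⁻¹' {v} := by ext x; simp
      rw [this]
      exact (hA u).inter (hB v)
    have h1 : iteratedJoin T P n = fun x =>
        (fun p : (Fin n → ι) × (Fin n → Option (Fin k)) => fun j => (p.2 j).getD (f (p.1 j)))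
          (iteratedJoin T Q n x, iteratedJoin T E n x) := by
      funext x j
      simp only [iteratedJoin, hEdef]
      split_ifs with h
      · simpa using h
      · simp
    have h2 := partitionEntropy_comp_le (μ := μ) hAB
      (fun p : (Fin n → ι) × (Fin n → Option (Fin k)) => fun j => (p.2 j).getD (f (p.1 j)))
    rw [← h1] at h2
    refine h2.trans ((partitionEntropy_prodMk_le hA hB).trans (add_le_add ?_ ?_))
    · refine (partitionEntropy_le_log_ncard hA).trans (Real.log_le_log ?_ ?_)
      · obtain ⟨x₀⟩ : Nonempty X := nonempty_of_isProbabilityMeasure μ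
        have h1 : 0 < (Set.range (iteratedJoin T Q n)).ncard :=
          (Set.ncard_pos (Set.toFinite _)).2 ⟨_, x₀, rfl⟩
        exact_mod_cast h1
      · exact_mod_cast hcount n
    · exact (partitionEntropy_iteratedJoin_le hinv hEm n).trans
        (mul_le_mul_of_nonneg_left hEη (Nat.cast_nonneg n))
  have hlim := (tendsto_log_poly_mul_pow_div (d := d) hC hb).eventually_lt_const
    (show Real.log b < Real.log b + η by linarith)
  refine limsup_le_of_le (by isBoundedDefault) ?_
  filter_upwards [hlim, eventually_gt_atTop 0] with n hn hn0
  have hn' : (0 : ℝ) < n := by exact_mod_cast hn0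
  refine EReal.coe_le_coe_iff.2 ?_
  calc _ ≤ (Real.log ((C * (n + 1) ^ d * b ^ n : ℕ) : ℝ) + n * η) / n := by
        gcongr
        exact hbound n
    _ = Real.log ((C * (n + 1) ^ d * b ^ n : ℕ) : ℝ) / n + η := by field_simp
    _ ≤ z := by rw [hη] at *; linarith

/-- One representative for each realised itinerary of a fine partition gives a dynamical cover. -/
theorem topologicalEntropy_le_log {X : Type*} [MetricSpace X] [MeasurableSpace X] [Nonempty X]
    {T : X → X} {b : ℕ} (hb : 0 < b) (hT : ItineraryGrowthLE T b) :
    topologicalEntropy T ≤ (Real.log b : EReal) := by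
  classical
  refine iSup₂_le fun U hU => ?_
  obtain ⟨ε, hε, hεU⟩ := Metric.mem_uniformity_dist.1 hU
  obtain ⟨ι, _, Q, -, hQd, C, d, hcount⟩ := hT ε hε
  have hC : 0 < C := by
    have h := hcount 0
    obtain ⟨x₀⟩ : Nonempty X := inferInstance
    have h1 : 0 < (Set.range (iteratedJoin T Q 0)).ncard :=
      (Set.ncard_pos (Set.toFinite _)).2 ⟨_, x₀, rfl⟩
    simp only [zero_add, one_pow, mul_one, pow_zero] at h
    omega
  have hcov : ∀ n, Dynamics.coverMincard T Set.univ U n ≤ ((C * (n + 1) ^ d * b ^ n : ℕ) : ℕ∞) := by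
    intro n
    set R := Set.range (iteratedJoin T Q n)
    have hsec : ∀ v : R, ∃ x, iteratedJoin T Q n x = v := fun v => v.2
    choose r hr using hsec
    have hfin : (Set.range r).Finite := Set.finite_range r
    have hcover : Dynamics.IsDynCoverOf T Set.univ U n (hfin.toFinset : Set X) := by
      intro x _
      refine ⟨r ⟨iteratedJoin T Q n x, x, rfl⟩, by simp, ?_⟩
      rw [Dynamics.mem_dynEntourage]
      intro k hk
      refine hεU (hQd _ _ ?_)
      exact (congrFun (hr ⟨iteratedJoin T Q n x, x, rfl⟩) ⟨k, hk⟩).symm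
    refine hcover.coverMincard_le_card.trans ?_
    have h1 : hfin.toFinset.card ≤ R.ncard := by
      rw [← Set.ncard_eq_toFinset_card _ hfin, ← Set.image_univ,
        ← Nat.card_coe_set_eq R, ← Set.ncard_univ]
      exact Set.ncard_image_le (Set.toFinite _)
    exact_mod_cast h1.trans (hcount n)
  have hlim := continuous_coe_real_ereal.continuousAt.tendsto.comp
    (tendsto_log_poly_mul_pow_div (d := d) hC hb)
  rw [← hlim.limsup_eq]
  refine limsup_le_limsup ?_
  filter_upwards [eventually_gt_atTop 0] with n hn
  have h1 : ENNReal.log ((Dynamics.coverMincard T Set.univ U n : ℕ∞) : ℝ≥0∞) ≤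
      ((Real.log ((C * (n + 1) ^ d * b ^ n : ℕ) : ℝ) : ℝ) : EReal) := by
    have hpos : 0 < ((C * (n + 1) ^ d * b ^ n : ℕ) : ℝ) := by
      have : 0 < C * (n + 1) ^ d * b ^ n := by positivity
      exact_mod_cast this
    rw [← ENNReal.log_ofReal_of_pos hpos]
    refine ENNReal.log_le_log ?_
    rw [ENNReal.ofReal_natCast]
    exact_mod_cast hcov n
  have hn' : (0 : EReal) ≤ n := by positivity
  refine (EReal.div_le_div_right_of_nonneg hn' h1).trans (le_of_eq ?_)
  rw [Function.comp_apply, EReal.coe_div]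
  rfl

/-! ### Coordinates on the circle -/

theorem UnitAddCircle.norm_coe_le (r : ℝ) : ‖(r : UnitAddCircle)‖ ≤ |r| := by
  rw [UnitAddCircle.norm_eq]
  simpa using round_le r 0

/-- The representative in `[a, a + 1)` of a point of `ℝ/ℤ`. -/
noncomputable def circleCoord (a : ℝ) (x : UnitAddCircle) : ℝ := AddCircle.equivIco 1 a x

theorem circleCoord_mem (a : ℝ) (x : UnitAddCircle) : circleCoord a x ∈ Set.Ico a (a + 1) :=
  (AddCircle.equivIco 1 a x).2

theorem coe_circleCoord (a : ℝ) (x : UnitAddCircle) : (circleCoord a x : UnitAddCircle) = x :=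
  AddCircle.coe_equivIco

theorem circleCoord_coe {a r : ℝ} (h : r ∈ Set.Ico a (a + 1)) :
    circleCoord a (r : UnitAddCircle) = r :=
  AddCircle.equivIco_coe_of_mem h

theorem measurable_circleCoord (a : ℝ) : Measurable (circleCoord a) :=
  measurable_subtype_coe.comp (AddCircle.measurableEquivIco 1 a).measurable

theorem dist_le_abs_circleCoord_sub (a : ℝ) (x y : UnitAddCircle) :
    dist x y ≤ |circleCoord a x - circleCoord a y| := by
  conv_lhs => rw [← coe_circleCoord a x, ← coe_circleCoord a y, dist_eq_norm, ← AddCircle.coe_sub]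
  exact UnitAddCircle.norm_coe_le _

theorem circleCoord_zero_coe (r : ℝ) : circleCoord 0 (r : UnitAddCircle) = Int.fract r := by
  simp [circleCoord]

theorem circleCoord_doublingMap_iterate (j : ℕ) (y : UnitAddCircle) :
    circleCoord 0 (doublingMap^[j] y) = Int.fract (2 ^ j * circleCoord 0 y) := by
  have h : doublingMap^[j] y = ((2 ^ j * circleCoord 0 y : ℝ) : UnitAddCircle) := by
    induction j with
    | zero => simp [coe_circleCoord]
    | succ j ih =>
      rw [Function.iterate_succ_apply', ih, doublingMap, ← AddCircle.coe_nsmul]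
      congr 1
      rw [nsmul_eq_mul]
      push_cast
      ring
  rw [h, circleCoord_zero_coe]

/-! ### Itineraries -/

theorem ncard_range_le_card_of_factor {X ι κ : Type*} [Fintype κ] {A : X → κ} {B : X → ι}
    (h : ∀ x y, A x = A y → B x = B y) : (Set.range B).ncard ≤ Fintype.card κ := by
  classical
  rcases isEmpty_or_nonempty X with hX | ⟨⟨x₀⟩⟩
  · simp [Set.range_eq_empty]
  have hsub : Set.range B ⊆
      (fun k => if hk : ∃ x, A x = k then B hk.choose else B x₀) '' Set.univ := by
    rintro _ ⟨x, rfl⟩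
    have hk : ∃ y, A y = A x := ⟨x, rfl⟩
    refine ⟨A x, trivial, ?_⟩
    simp only [dif_pos hk]
    exact h _ _ hk.choose_spec
  calc (Set.range B).ncard ≤ _ := Set.ncard_le_ncard hsub (Set.toFinite _)
    _ ≤ (Set.univ : Set κ).ncard := Set.ncard_image_le (Set.toFinite _)
    _ = Fintype.card κ := by rw [Set.ncard_univ, Nat.card_eq_fintype_card]

/-- A monotone word is determined by the number of positions with letter at most i, for each of the
`N` letters i; each number takes n + 1 values. -/
theorem ncard_monotone_le (n N : ℕ) :
    {f : Fin n → Fin N | Monotone f}.ncard ≤ (n + 1) ^ N := by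
  classical
  have hcard : (Set.univ : Set (Fin N → Fin (n + 1))).ncard = (n + 1) ^ N := by
    rw [Set.ncard_univ, Nat.card_eq_fintype_card]
    simp
  rw [← hcard]
  have hle : ∀ (f : Fin n → Fin N) i, (Finset.univ.filter fun j => f j ≤ i).card < n + 1 := by
    intro f i
    have := Finset.card_filter_le (Finset.univ : Finset (Fin n)) (fun j => f j ≤ i)
    simp only [Finset.card_univ, Fintype.card_fin] at this
    omega
  refine Set.ncard_le_ncard_of_injOn (fun f i => ⟨_, hle f i⟩) (fun _ _ => trivial) ?_
    (Set.toFinite _)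
  intro f hf g hg hfg
  -- Sublevel sets of monotone words are initial segments, hence nested, so equal cardinality forces
  -- equality.
  have hset : ∀ i, (Finset.univ.filter fun j => f j ≤ i) = Finset.univ.filter fun j => g j ≤ i := by
    intro i
    have hc : (Finset.univ.filter fun j => f j ≤ i).card =
        (Finset.univ.filter fun j => g j ≤ i).card := congrArg Fin.val (congrFun hfg i)
    have hl : ∀ {f : Fin n → Fin N}, Monotone f → IsLowerSet {j | f j ≤ i} :=
      fun hf a b hab h => (hf hab).trans h
    rcases (hl hf).total (hl hg) with h | h
    · refine Finset.eq_of_subset_of_card_le (fun j hj => ?_) hc.ge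
      simpa using h (by simpa using hj : j ∈ {j | f j ≤ i})
    · refine (Finset.eq_of_subset_of_card_le (fun j hj => ?_) hc.le).symm
      simpa using h (by simpa using hj : j ∈ {j | g j ≤ i})
  have hiff : ∀ i j, f j ≤ i ↔ g j ≤ i := fun i j => by
    simpa using Finset.ext_iff.1 (hset i) j
  funext j
  exact le_antisymm ((hiff _ _).2 le_rfl) ((hiff _ _).1 le_rfl)

theorem measurableSet_fibre_of_measurable {X ι : Type*} [MeasurableSpace X] [MeasurableSpace ι]
    [MeasurableSingletonClass ι] {Q : X → ι} (hQ : Measurable Q) (i : ι) :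
    MeasurableSet (Q ⁻¹' {i}) := hQ (measurableSet_singleton i)

theorem measurable_finMk {X : Type*} [MeasurableSpace X] {N : ℕ} {f : X → ℕ} (hf : Measurable f)
    (hN : ∀ x, f x < N) : Measurable fun x => (⟨f x, hN x⟩ : Fin N) := by
  refine measurable_to_countable' fun i => ?_
  have : (fun x => (⟨f x, hN x⟩ : Fin N)) ⁻¹' {i} = f ⁻¹' {i.val} := by
    ext x
    simp [Fin.ext_iff]
  rw [this]
  exact hf (measurableSet_singleton _)

/-- The number of the arc `[a + i / N, a + (i + 1) / N)` that contains a point. -/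
noncomputable def arcIndex (a : ℝ) (N : ℕ) (x : UnitAddCircle) : ℕ :=
  ⌊(N : ℝ) * (circleCoord a x - a)⌋₊

theorem arcIndex_lt {a : ℝ} {N : ℕ} (hN : 0 < N) (x : UnitAddCircle) : arcIndex a N x < N := by
  have h := circleCoord_mem a x
  have hN' : (0 : ℝ) < N := by exact_mod_cast hN
  rw [arcIndex, Nat.floor_lt (mul_nonneg hN'.le (sub_nonneg.2 h.1))]
  nlinarith [h.2]

theorem measurable_arcIndex (a : ℝ) (N : ℕ) : Measurable (arcIndex a N) :=
  Nat.measurable_floor.comp (((measurable_circleCoord a).sub_const a).const_mul _)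

theorem dist_lt_of_arcIndex_eq {a : ℝ} {N : ℕ} (hN : 0 < N) {x y : UnitAddCircle}
    (h : arcIndex a N x = arcIndex a N y) : dist x y < 1 / N := by
  have hN' : (0 : ℝ) < N := by exact_mod_cast hN
  have hx := mul_nonneg hN'.le (sub_nonneg.2 (circleCoord_mem a x).1)
  have hy := mul_nonneg hN'.le (sub_nonneg.2 (circleCoord_mem a y).1)
  refine (dist_le_abs_circleCoord_sub a x y).trans_lt ?_
  have h1 := Nat.floor_le hx
  have h2 := Nat.lt_floor_add_one ((N : ℝ) * (circleCoord a x - a))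
  have h3 := Nat.floor_le hy
  have h4 := Nat.lt_floor_add_one ((N : ℝ) * (circleCoord a y - a))
  have h' : ⌊(N : ℝ) * (circleCoord a x - a)⌋₊ = ⌊(N : ℝ) * (circleCoord a y - a)⌋₊ := h
  rw [h'] at h1 h2
  rw [lt_div_iff₀ hN', ← abs_of_pos hN', ← abs_mul, abs_lt]
  constructor <;> nlinarith

/-! ### Dyadic arcs and binary digits under doubling -/

theorem floor_two_pow_mul_fract (M : ℕ) (t : ℝ) :
    ⌊(2 : ℝ) ^ M * Int.fract t⌋ = ⌊(2 : ℝ) ^ M * t⌋ - 2 ^ M * ⌊t⌋ := by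
  have h : (2 : ℝ) ^ M * Int.fract t = 2 ^ M * t - ((2 ^ M * ⌊t⌋ : ℤ) : ℝ) := by
    rw [Int.fract]
    push_cast
    ring
  rw [h, Int.floor_sub_intCast]

/-- The first n binary digits determine the first m: the coarse floor is the integer quotient of the
fine one by 2^(n-m). -/
theorem floor_two_pow_mul_eq_of_le {s t : ℝ} {m n : ℕ} (hmn : m ≤ n)
    (h : ⌊(2 : ℝ) ^ n * s⌋ = ⌊(2 : ℝ) ^ n * t⌋) : ⌊(2 : ℝ) ^ m * s⌋ = ⌊(2 : ℝ) ^ m * t⌋ := by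
  have key : ∀ r : ℝ, ⌊(2 : ℝ) ^ m * r⌋ = ⌊(2 : ℝ) ^ n * r⌋ / ((2 ^ (n - m) : ℕ) : ℤ) := by
    intro r
    rw [← Int.floor_div_natCast]
    congr 1
    have : (2 : ℝ) ^ n = 2 ^ m * 2 ^ (n - m) := by rw [← pow_add, Nat.add_sub_cancel' hmn]
    rw [this]
    push_cast
    field_simp
  rw [key, key, h]

theorem natCast_arcIndex_zero (N : ℕ) (x : UnitAddCircle) :
    ((arcIndex 0 N x : ℕ) : ℤ) = ⌊(N : ℝ) * circleCoord 0 x⌋ := by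
  rw [arcIndex, sub_zero, Int.natCast_floor_eq_floor]
  exact mul_nonneg (Nat.cast_nonneg _) (circleCoord_mem 0 x).1

theorem arcIndex_two_pow_doublingMap_iterate (M j : ℕ) (y : UnitAddCircle) :
    ((arcIndex 0 (2 ^ M) (doublingMap^[j] y) : ℕ) : ℤ) =
      ⌊(2 : ℝ) ^ (M + j) * circleCoord 0 y⌋ - 2 ^ M * ⌊(2 : ℝ) ^ j * circleCoord 0 y⌋ := by
  rw [natCast_arcIndex_zero, circleCoord_doublingMap_iterate]
  push_cast
  rw [floor_two_pow_mul_fract, pow_add, mul_assoc]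

/-- The j-th iterate reads the `M` binary digits after position j, and these are among the first `M
+ n`. -/
theorem arcIndex_doublingMap_iterate_congr {M n : ℕ} {y z : UnitAddCircle}
    (h : arcIndex 0 (2 ^ (M + n)) y = arcIndex 0 (2 ^ (M + n)) z) {j : ℕ} (hj : j ≤ n) :
    arcIndex 0 (2 ^ M) (doublingMap^[j] y) = arcIndex 0 (2 ^ M) (doublingMap^[j] z) := by
  have h' : ⌊(2 : ℝ) ^ (M + n) * circleCoord 0 y⌋ = ⌊(2 : ℝ) ^ (M + n) * circleCoord 0 z⌋ := by
    have := congrArg (Nat.cast : ℕ → ℤ) h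
    rw [natCast_arcIndex_zero, natCast_arcIndex_zero] at this
    exact_mod_cast this
  zify
  rw [arcIndex_two_pow_doublingMap_iterate, arcIndex_two_pow_doublingMap_iterate,
    floor_two_pow_mul_eq_of_le (by omega : M + j ≤ M + n) h',
    floor_two_pow_mul_eq_of_le (by omega : j ≤ M + n) h']

/-- The binary itinerary spells out the first n digits; the induction appends one digit at a time.
-/
theorem arcIndex_eq_of_binary_itinerary_eq {n : ℕ} {y z : UnitAddCircle}
    (h : ∀ j < n, arcIndex 0 2 (doublingMap^[j] y) = arcIndex 0 2 (doublingMap^[j] z)) :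
    arcIndex 0 (2 ^ n) y = arcIndex 0 (2 ^ n) z := by
  induction n with
  | zero =>
    have h1 := arcIndex_lt (a := 0) (N := 2 ^ 0) (by norm_num) y
    have h2 := arcIndex_lt (a := 0) (N := 2 ^ 0) (by norm_num) z
    omega
  | succ n ih =>
    have h1 := ih fun j hj => h j (by omega)
    have h2 := h n (by omega)
    have key : ∀ y, ((arcIndex 0 (2 ^ (n + 1)) y : ℕ) : ℤ) =
        ((arcIndex 0 2 (doublingMap^[n] y) : ℕ) : ℤ) + 2 * ((arcIndex 0 (2 ^ n) y : ℕ) : ℤ) := by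
      intro y
      have h3 := arcIndex_two_pow_doublingMap_iterate 1 n y
      rw [pow_one] at h3
      rw [h3, natCast_arcIndex_zero, natCast_arcIndex_zero, add_comm 1 n]
      push_cast
      ring
    zify
    rw [key, key, h1, h2]

theorem volume_arcIndex_fibre_le {N : ℕ} (hN : 0 < N) (m : ℕ) :
    volume (arcIndex 0 N ⁻¹' {m}) ≤ ENNReal.ofReal (1 / N) := by
  have hN' : (0 : ℝ) < N := by exact_mod_cast hN
  have hsub : arcIndex 0 N ⁻¹' {m} ⊆
      -- The ball is centred at the midpoint of the arc, with half its length as radius.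
      Metric.closedBall ((((m : ℝ) + 1 / 2) / N : ℝ) : UnitAddCircle) (1 / N / 2) := by
    intro x hx
    have hx' : ⌊(N : ℝ) * (circleCoord 0 x - 0)⌋₊ = m := hx
    rw [sub_zero] at hx'
    have h0 := mul_nonneg hN'.le (circleCoord_mem 0 x).1
    have h1 := Nat.floor_le h0
    have h2 := Nat.lt_floor_add_one ((N : ℝ) * circleCoord 0 x)
    rw [hx'] at h1 h2
    rw [Metric.mem_closedBall]
    conv_lhs => rw [← coe_circleCoord 0 x, dist_eq_norm, ← AddCircle.coe_sub]
    refine (UnitAddCircle.norm_coe_le _).trans ?_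
    have : circleCoord 0 x - ((m : ℝ) + 1 / 2) / N = (N * circleCoord 0 x - (m + 1 / 2)) / N := by
      field_simp
    rw [this, abs_div, abs_of_pos hN', div_right_comm]
    gcongr
    rw [abs_le]
    constructor <;> linarith
  refine (measure_mono hsub).trans ?_
  rw [AddCircle.volume_closedBall]
  refine ENNReal.ofReal_le_ofReal ((min_le_right _ _).trans (le_of_eq ?_))
  ring

/-! ### Drifts on the circle -/

/-- The map moving every point `x` of the circle by `g x` in the positive direction. -/
def driftMap (g : UnitAddCircle → ℝ) (x : UnitAddCircle) : UnitAddCircle := x + (g x : ℝ)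

/-- `g` is a nonnegative speed that is too small for `driftMap g` to jump over the point `a`. -/
def IsDriftBefore (g : UnitAddCircle → ℝ) (a : ℝ) : Prop :=
  ∀ x, 0 ≤ g x ∧ g x ≤ dist x (a : UnitAddCircle) / 2

/-- The remaining way to `a + 1` is at least the distance to `a`, and a step covers at most half of
that distance, so the coordinate does not wrap around. -/
theorem circleCoord_driftMap {g : UnitAddCircle → ℝ} {a : ℝ} (hg : IsDriftBefore g a)
    (x : UnitAddCircle) : circleCoord a (driftMap g x) = circleCoord a x + g x := by
  have hx := circleCoord_mem a x
  have h1 : ((a + 1 : ℝ) : UnitAddCircle) = a := by simp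
  have h2 : dist x (a : UnitAddCircle) ≤ a + 1 - circleCoord a x := by
    conv_lhs => rw [← coe_circleCoord a x, ← h1, dist_eq_norm, ← AddCircle.coe_sub]
    refine (UnitAddCircle.norm_coe_le _).trans ?_
    rw [abs_sub_comm, abs_of_pos (by linarith [hx.2])]
  have h3 : driftMap g x = ((circleCoord a x + g x : ℝ) : UnitAddCircle) := by
    rw [driftMap, AddCircle.coe_add, coe_circleCoord]
  rw [h3]
  refine circleCoord_coe ⟨?_, ?_⟩
  · linarith [hx.1, (hg x).1]
  · linarith [hx.2, (hg x).2]

/-- The speed is the coboundary of the bounded coordinate `circleCoord a`, so it has integral zero;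
being nonnegative, it vanishes almost everywhere. -/
theorem ae_eq_zero_of_invariant_driftMap {g : UnitAddCircle → ℝ} {a : ℝ} (hg : IsDriftBefore g a)
    {ν : Measure UnitAddCircle} (hν : IsInvariantProbability (driftMap g) ν) :
    ∀ᵐ x ∂ν, g x = 0 := by
  obtain ⟨hprob, hinv⟩ := hν
  have hint : Integrable (circleCoord a) ν := by
    refine Integrable.of_bound (measurable_circleCoord a).aestronglyMeasurable (|a| + 1)
      (Eventually.of_forall fun x => ?_)
    have := circleCoord_mem a x
    rw [Real.norm_eq_abs, abs_le]
    constructor <;> linarith [this.1, this.2, neg_abs_le a, le_abs_self a]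
  have hint' : Integrable (fun x => circleCoord a (driftMap g x)) ν :=
    hinv.integrable_comp_of_integrable hint
  have hgeq : g = fun x => circleCoord a (driftMap g x) - circleCoord a x := by
    funext x
    rw [circleCoord_driftMap hg]
    ring
  have hgint : Integrable g ν := by
    rw [hgeq]
    exact hint'.sub hint
  have hzero : ∫ x, g x ∂ν = 0 := by
    have h1 : ∫ x, circleCoord a (driftMap g x) ∂ν = ∫ x, circleCoord a x ∂ν := by
      rw [← integral_map hinv.aemeasurable
        (measurable_circleCoord a).aestronglyMeasurable, hinv.map_eq]
    have h2 : ∫ x, g x ∂ν = ∫ x, (circleCoord a (driftMap g x) - circleCoord a x) ∂ν :=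
      integral_congr_ae (Eventually.of_forall fun x => congrFun hgeq x)
    rw [h2, integral_sub hint' hint, h1, sub_self]
  exact (integral_eq_zero_iff_of_nonneg (fun x => (hg x).1) hgint).1 hzero

theorem monotone_arcIndex_driftMap_iterate {g : UnitAddCircle → ℝ} {a : ℝ}
    (hg : IsDriftBefore g a) (N : ℕ) (x : UnitAddCircle) :
    Monotone fun j : ℕ => arcIndex a N ((driftMap g)^[j] x) := by
  refine monotone_nat_of_le_succ fun j => ?_
  rw [Function.iterate_succ_apply', arcIndex, arcIndex, circleCoord_driftMap hg]
  refine Nat.floor_le_floor (mul_le_mul_of_nonneg_left ?_ (Nat.cast_nonneg N))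
  linarith [(hg ((driftMap g)^[j] x)).1]

theorem itineraryGrowthLE_driftMap_prod {g : UnitAddCircle → ℝ} {a : ℝ} (hg : IsDriftBefore g a) :
    ItineraryGrowthLE (Prod.map (driftMap g) doublingMap) 2 := by
  intro ε hε
  obtain ⟨M, hM⟩ := exists_pow_lt_of_lt_one hε (by norm_num : (1 / 2 : ℝ) < 1)
  have hN : 0 < 2 ^ M := by positivity
  have hNε : 1 / ((2 ^ M : ℕ) : ℝ) < ε := by
    push_cast
    rwa [one_div_pow] at hM
  set q : ℝ → UnitAddCircle → Fin (2 ^ M) := fun c x => ⟨arcIndex c (2 ^ M) x, arcIndex_lt hN x⟩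
    with hq
  have hqm : ∀ c, Measurable (q c) := fun c =>
    measurable_finMk (measurable_arcIndex c (2 ^ M)) (arcIndex_lt hN)
  set Q : UnitAddCircle × UnitAddCircle → Fin (2 ^ M) × Fin (2 ^ M) :=
    fun p => (q a p.1, q 0 p.2) with hQ
  -- The exponent of n + 1 is the number of arcs on the first factor; the constant `2 ^ M` is the
  -- surplus in the `2 ^ (M + n)` dyadic arcs on the second.
  refine ⟨_, inferInstance, Q, fun i => measurableSet_fibre_of_measurable
    (((hqm a).comp measurable_fst).prodMk ((hqm 0).comp measurable_snd)) i, ?_, 2 ^ M, 2 ^ M, ?_⟩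
  · intro x y hxy
    have h1 : arcIndex a (2 ^ M) x.1 = arcIndex a (2 ^ M) y.1 :=
      congrArg Fin.val (congrArg Prod.fst hxy)
    have h2 : arcIndex 0 (2 ^ M) x.2 = arcIndex 0 (2 ^ M) y.2 :=
      congrArg Fin.val (congrArg Prod.snd hxy)
    rw [Prod.dist_eq]
    exact max_lt ((dist_lt_of_arcIndex_eq hN h1).trans hNε)
      ((dist_lt_of_arcIndex_eq hN h2).trans hNε)
  · intro n
    classical
    set R : Set (Fin n → Fin (2 ^ M)) := Set.range (iteratedJoin (driftMap g) (q a) n) with hR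
    have hRcard : R.ncard ≤ (n + 1) ^ (2 ^ M) := by
      refine (Set.ncard_le_ncard ?_ (Set.toFinite _)).trans (ncard_monotone_le n (2 ^ M))
      rintro _ ⟨x, rfl⟩ i j hij
      exact monotone_arcIndex_driftMap_iterate hg (2 ^ M) x hij
    have hfac := ncard_range_le_card_of_factor
      (A := fun p : UnitAddCircle × UnitAddCircle =>
        ((⟨iteratedJoin (driftMap g) (q a) n p.1, p.1, rfl⟩ : R),
          (⟨arcIndex 0 (2 ^ (M + n)) p.2, arcIndex_lt (by positivity) p.2⟩ : Fin (2 ^ (M + n)))))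
      (B := iteratedJoin (Prod.map (driftMap g) doublingMap) Q n) (by
        intro x y hxy
        have h1 : iteratedJoin (driftMap g) (q a) n x.1 = iteratedJoin (driftMap g) (q a) n y.1 :=
          congrArg Subtype.val (congrArg Prod.fst hxy)
        have h2 : arcIndex 0 (2 ^ (M + n)) x.2 = arcIndex 0 (2 ^ (M + n)) y.2 :=
          congrArg Fin.val (congrArg Prod.snd hxy)
        funext j
        simp only [iteratedJoin, Prod.map_iterate, hQ, Prod.map_fst, Prod.map_snd]
        refine Prod.ext (congrFun h1 j) (Fin.ext ?_)
        exact arcIndex_doublingMap_iterate_congr h2 j.2.le)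
    refine hfac.trans ?_
    rw [Fintype.card_prod, Fintype.card_fin, ← Nat.card_eq_fintype_card, Nat.card_coe_set_eq,
      pow_add]
    calc R.ncard * (2 ^ M * 2 ^ n) ≤ (n + 1) ^ (2 ^ M) * (2 ^ M * 2 ^ n) := by gcongr
      _ = _ := by ring

/-! ### Lower bounds for the entropy of products with the doubling map -/

theorem UnitAddCircle.isProbabilityMeasure_volume :
    IsProbabilityMeasure (volume : Measure UnitAddCircle) := ⟨UnitAddCircle.measure_univ⟩

theorem measurable_doublingMap : Measurable doublingMap :=
  (AddCircle.ergodic_nsmul (T := 1) one_lt_two).measurable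

theorem measurePreserving_doublingMap : MeasurePreserving doublingMap volume volume :=
  (AddCircle.ergodic_nsmul (T := 1) one_lt_two).toMeasurePreserving

/-- Cut only the second factor, into two half circles. A set of points sharing an n-itinerary lies
over one dyadic arc and has mass at most 2^(-n), so every atom has information at least n log 2. -/
theorem log_two_le_measureEntropy_prod {S : UnitAddCircle → UnitAddCircle} (hS : Measurable S)
    (ν : Measure UnitAddCircle) [IsProbabilityMeasure ν] :
    (Real.log 2 : EReal) ≤ measureEntropy (Prod.map S doublingMap) (ν.prod volume) := by
  classical
  have := UnitAddCircle.isProbabilityMeasure_volume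
  set P : UnitAddCircle × UnitAddCircle → Fin 2 := fun p => ⟨arcIndex 0 2 p.2, arcIndex_lt two_pos _⟩
    with hP
  have hPm : Measurable P :=
    measurable_finMk ((measurable_arcIndex 0 2).comp measurable_snd) fun _ => arcIndex_lt two_pos _
  have hTm : Measurable (Prod.map S doublingMap) := hS.prodMap measurable_doublingMap
  refine le_iSup_of_le 2 (le_iSup_of_le P (le_iSup_of_le hPm ?_))
  refine le_limsup_of_frequently_le (Eventually.frequently ?_) (by isBoundedDefault)
  filter_upwards [eventually_gt_atTop 0] with n hn
  have hn' : (0 : ℝ) < n := by exact_mod_cast hn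
  refine EReal.coe_le_coe_iff.2 ?_
  rw [le_div_iff₀ hn']
  set A := iteratedJoin (Prod.map S doublingMap) P n with hA
  have hAm : ∀ v, MeasurableSet (A ⁻¹' {v}) :=
    measurableSet_iteratedJoin_fibre hTm (measurableSet_fibre_of_measurable hPm) n
  have hsmall : ∀ v, (ν.prod volume).real (A ⁻¹' {v}) ≤ 1 / 2 ^ n := by
    intro v
    rcases (A ⁻¹' {v}).eq_empty_or_nonempty with h | ⟨p, hp⟩
    · rw [h, measureReal_empty]; positivity
    have hsub : A ⁻¹' {v} ⊆ Set.univ ×ˢ (arcIndex 0 (2 ^ n) ⁻¹' {arcIndex 0 (2 ^ n) p.2}) := by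
      intro r hr
      refine ⟨trivial, arcIndex_eq_of_binary_itinerary_eq fun j hj => ?_⟩
      have h : A r ⟨j, hj⟩ = A p ⟨j, hj⟩ := by
        rw [show A r = v from hr, show A p = v from hp]
      simp only [hA, iteratedJoin, Prod.map_iterate, hP] at h
      exact congrArg Fin.val h
    refine ENNReal.toReal_le_of_le_ofReal (by positivity) ((measure_mono hsub).trans ?_)
    rw [Measure.prod_prod, measure_univ, one_mul]
    simpa using volume_arcIndex_fibre_le (N := 2 ^ n) (by positivity) (arcIndex 0 (2 ^ n) p.2)
  have hterm : ∀ v, (ν.prod volume).real (A ⁻¹' {v}) * (n * Real.log 2) ≤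
      Real.negMulLog ((ν.prod volume).real (A ⁻¹' {v})) := by
    intro v
    rcases (measureReal_nonneg (μ := ν.prod volume) (s := A ⁻¹' {v})).eq_or_lt with h | h
    · simp [← h]
    have h1 := Real.log_le_log h (hsmall v)
    rw [one_div, Real.log_inv, Real.log_pow] at h1
    rw [Real.negMulLog]
    nlinarith
  calc Real.log 2 * n = ∑ v, (ν.prod volume).real (A ⁻¹' {v}) * (n * Real.log 2) := by
        rw [← Finset.sum_mul, sum_measureReal_fibres hAm]
        ring
    _ ≤ partitionEntropy (ν.prod volume) A := Finset.sum_le_sum fun v _ => hterm v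

/-! ### Expansion of the doubling map and separated points -/

theorem UnitAddCircle.norm_two_nsmul {w : UnitAddCircle} (hw : ‖w‖ < 1 / 4) :
    ‖2 • w‖ = 2 * ‖w‖ := by
  have key : ∀ r : ℝ, |r| ≤ 1 / 2 → ‖(r : UnitAddCircle)‖ = |r| := fun r hr =>
    (AddCircle.norm_coe_eq_abs_iff 1 one_ne_zero).2 (by simpa using hr)
  set r := circleCoord (-(1 / 2)) w with hr
  have hmem := circleCoord_mem (-(1 / 2)) w
  have hrw : (r : UnitAddCircle) = w := coe_circleCoord _ w
  have h1 : ‖w‖ = |r| := by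
    rw [← hrw]
    refine key r (abs_le.2 ⟨hmem.1, ?_⟩)
    linarith [hmem.2]
  have h2 : (2 : ℕ) • w = ((2 * r : ℝ) : UnitAddCircle) := by
    rw [← hrw, ← AddCircle.coe_nsmul, nsmul_eq_mul, Nat.cast_ofNat]
  rw [h1] at hw
  rw [h2, key _ (by rw [abs_mul, abs_two]; linarith), abs_mul, abs_two, h1]

/-- Distances below 1/4 double exactly, so the initial distance has been multiplied by 2^n when the
orbits meet. -/
theorem eq_of_dist_doublingMap_iterate_lt {n : ℕ} {y z : UnitAddCircle}
    (h : ∀ j < n, dist (doublingMap^[j] y) (doublingMap^[j] z) < 1 / 4)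
    (hn : doublingMap^[n] y = doublingMap^[n] z) : y = z := by
  have key : ∀ j ≤ n, dist (doublingMap^[j] y) (doublingMap^[j] z) = 2 ^ j * dist y z := by
    intro j hj
    induction j with
    | zero => simp
    | succ j ih =>
      have h1 := h j (by omega)
      rw [Function.iterate_succ_apply', Function.iterate_succ_apply', doublingMap, doublingMap,
        dist_eq_norm, ← smul_sub, UnitAddCircle.norm_two_nsmul (by rwa [← dist_eq_norm]),
        ← dist_eq_norm, ih (by omega)]
      ring
  have h2 := key n le_rfl
  rw [hn, dist_self] at h2
  exact dist_eq_zero.1 ((mul_eq_zero.1 h2.symm).resolve_left (by positivity))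

/-- The 2^n points j / 2^n all reach 0 at time n, so by expansion two of them whose orbits stay
within 1/4 coincide. The radius 1/8 is half of that, since a net requires disjoint dynamical balls.
The first coordinate is constant, so `S` plays no role. -/
theorem log_two_le_topologicalEntropy_prod (S : UnitAddCircle → UnitAddCircle) :
    (Real.log 2 : EReal) ≤ topologicalEntropy (Prod.map S doublingMap) := by
  classical
  set U : Set ((UnitAddCircle × UnitAddCircle) × (UnitAddCircle × UnitAddCircle)) :=
    {p | dist p.1 p.2 < 1 / 8} with hU
  have hUmem : U ∈ uniformity (UnitAddCircle × UnitAddCircle) :=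
    Metric.dist_mem_uniformity (by norm_num)
  refine le_trans ?_ (Dynamics.netEntropyEntourage_le_coverEntropy (T := Prod.map S doublingMap)
    (F := Set.univ) hUmem)
  have hlog : (Real.log 2 : EReal) = ENNReal.log 2 := by
    rw [← ENNReal.log_ofReal_of_pos two_pos]
    simp
  rw [hlog, ← ExpGrowth.expGrowthSup_pow]
  refine ExpGrowth.expGrowthSup_monotone fun n => ?_
  set pt : ℕ → UnitAddCircle × UnitAddCircle :=
    fun j => (0, (((j : ℝ) / 2 ^ n : ℝ) : UnitAddCircle)) with hpt
  have hmem : ∀ j : ℕ, j < 2 ^ n → (j : ℝ) / 2 ^ n ∈ Set.Ico (0 : ℝ) (0 + 1) := fun j hj => by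
    refine ⟨by positivity, ?_⟩
    rw [zero_add, div_lt_one (by positivity)]
    exact_mod_cast hj
  have hinj : Set.InjOn pt (Finset.range (2 ^ n) : Finset ℕ) := by
    intro i hi j hj hij
    have h1 := congrArg (fun p => circleCoord 0 p.2) hij
    simp only [hpt] at h1
    rw [circleCoord_coe (hmem i (by simpa using hi)), circleCoord_coe (hmem j (by simpa using hj)),
      div_left_inj' (by positivity)] at h1
    exact_mod_cast h1
  have hend : ∀ j, doublingMap^[n] (pt j).2 = 0 := by
    intro j
    have h1 := circleCoord_doublingMap_iterate n (pt j).2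
    rw [circleCoord_zero_coe] at h1
    have h2 : (2 : ℝ) ^ n * Int.fract ((j : ℝ) / 2 ^ n) =
        (((j : ℤ) - 2 ^ n * ⌊(j : ℝ) / 2 ^ n⌋ : ℤ) : ℝ) := by
      rw [Int.fract]
      push_cast
      field_simp
    rw [h2, Int.fract_intCast] at h1
    rw [← coe_circleCoord 0 (doublingMap^[n] (pt j).2), h1]
    simp
  have hnet : Dynamics.IsDynNetIn (Prod.map S doublingMap) Set.univ U n
      ((Finset.range (2 ^ n)).image pt : Finset _) := by
    refine ⟨Set.subset_univ _, ?_⟩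
    intro p hp r hr hpr
    refine Set.disjoint_left.2 fun w hw1 hw2 => hpr ?_
    rw [Finset.coe_image] at hp hr
    obtain ⟨i, -, rfl⟩ := hp
    obtain ⟨j, -, rfl⟩ := hr
    rw [Dynamics.mem_ball_dynEntourage] at hw1 hw2
    have h2 : (pt i).2 = (pt j).2 := by
      refine eq_of_dist_doublingMap_iterate_lt (n := n) (fun k hk => ?_) ((hend i).trans (hend j).symm)
      have d1 : dist _ _ < (1 / 8 : ℝ) := hw1 k hk
      have d2 : dist _ _ < (1 / 8 : ℝ) := hw2 k hk
      rw [Prod.map_iterate, Prod.dist_eq] at d1 d2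
      have e1 := (le_max_right _ _).trans_lt d1
      have e2 := (le_max_right _ _).trans_lt d2
      have := dist_triangle_right (doublingMap^[k] (pt i).2) (doublingMap^[k] (pt j).2)
        (doublingMap^[k] w.2)
      simp only [Prod.map_snd] at e1 e2
      linarith
    exact Prod.ext rfl h2
  have hcard := hnet.card_le_netMaxcard
  rw [Finset.card_image_of_injOn hinj, Finset.card_range] at hcard
  have : ((2 ^ n : ℕ) : ℝ≥0∞) ≤
      ((Dynamics.netMaxcard (Prod.map S doublingMap) Set.univ U n : ℕ∞) : ℝ≥0∞) := by
    exact_mod_cast hcard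
  simpa using this

/-! ### Lipschitz maps that are computable on ideal points -/

/-- The images of the ideal points are computable, uniformly in the ideal point. -/
def ComputableOnIdeal {X Y : Type*} [MetricSpace X] [ComputableMetricSpace X] [MetricSpace Y]
    [ComputableMetricSpace Y] (f : X → Y) : Prop :=
  ∃ h : ℕ × ℕ → ℕ, Computable h ∧ ∀ i n : ℕ, dist (ComputableMetricSpace.ideal (h (i, n)) : Y)
    (f (ComputableMetricSpace.ideal i)) ≤ 1 / ((n : ℝ) + 1)

theorem inv_two_pow_le_one_div (n : ℕ) : (2 : ℝ)⁻¹ ^ n ≤ 1 / ((n : ℝ) + 1) := by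
  rw [inv_pow, ← one_div]
  refine one_div_le_one_div_of_le (by positivity) ?_
  exact_mod_cast Nat.lt_two_pow_self (n := n)

/-- Clearing denominators turns the enumeration criterion of `ComputableOnIdeal.isComputableMap`
into a primitive recursive relation of naturals. -/
theorem ratOfCode_add_lt_iff (c : ℕ × ℕ × ℕ) (k m k' m' : ℕ) :
    (ratOfCode c : ℝ) + 4 * (((k : ℝ) + 1) / (m + 1)) < ((k' : ℝ) + 1) / (m' + 1) ↔
      (c.1 * (m + 1) + 4 * (k + 1) * (c.2.2 + 1)) * (m' + 1) <
        (k' + 1) * (c.2.2 + 1) * (m + 1) + c.2.1 * (m + 1) * (m' + 1) := by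
  unfold ratOfCode
  push_cast
  have e : ((c.1 : ℝ) - c.2.1) / (c.2.2 + 1) + 4 * (((k : ℝ) + 1) / (m + 1)) =
      (((c.1 : ℝ) - c.2.1) * (m + 1) + 4 * (k + 1) * (c.2.2 + 1)) / ((c.2.2 + 1) * (m + 1)) := by
    field_simp
  rw [e, div_lt_div_iff₀ (by positivity) (by positivity), ← @Nat.cast_lt ℝ]
  push_cast
  constructor <;> intro h <;> linarith

/-- A source ball of radius r is enumerated when the approximate distance from the image of its
centre to the target centre, plus 4r, is below the target radius. The 4r pays for the Lipschitz
spread 2r, the error in the image and the error in the distance, each error being at most 1/(m + 1)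
≤ r. -/
theorem ComputableOnIdeal.isComputableMap {X Y : Type*} [MetricSpace X] [ComputableMetricSpace X]
    [MetricSpace Y] [ComputableMetricSpace Y] {f : X → Y} (hf : ComputableOnIdeal f)
    (hL : LipschitzWith 2 f) : IsComputableMap f := by
  obtain ⟨h, hh, hhf⟩ := hf
  obtain ⟨D, ⟨c, hc, hDc⟩, hD⟩ := ComputableMetricSpace.dist_ideal (X := Y)
  set cc : (ℕ × ℕ × ℕ) × (ℕ × ℕ × ℕ) → ℕ × ℕ × ℕ :=
    fun q => c ((h (q.2.1, q.2.2.2), q.1.1), q.2.2.2) with hcc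
  have hccc : Computable cc := by
    have i1 : Computable (fun q : (ℕ × ℕ × ℕ) × (ℕ × ℕ × ℕ) => q.2.1) :=
      Computable.fst.comp Computable.snd
    have m1 : Computable (fun q : (ℕ × ℕ × ℕ) × (ℕ × ℕ × ℕ) => q.2.2.2) :=
      Computable.snd.comp (Computable.snd.comp Computable.snd)
    have s1 : Computable (fun q : (ℕ × ℕ × ℕ) × (ℕ × ℕ × ℕ) => q.1.1) :=
      Computable.fst.comp Computable.fst
    exact hc.comp (((hh.comp (i1.pair m1)).pair s1).pair m1)
  have hprim : PrimrecPred (fun q : (ℕ × ℕ × ℕ) × ((ℕ × ℕ × ℕ) × (ℕ × ℕ × ℕ)) =>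
      (q.1.1 * (q.2.2.2.2 + 1) + 4 * (q.2.2.2.1 + 1) * (q.1.2.2 + 1)) * (q.2.1.2.2 + 1) <
        (q.2.1.2.1 + 1) * (q.1.2.2 + 1) * (q.2.2.2.2 + 1) +
          q.1.2.1 * (q.2.2.2.2 + 1) * (q.2.1.2.2 + 1)) := by
    have a : Primrec (fun q : (ℕ × ℕ × ℕ) × ((ℕ × ℕ × ℕ) × (ℕ × ℕ × ℕ)) => q.1.1) :=
      Primrec.fst.comp Primrec.fst
    have b : Primrec (fun q : (ℕ × ℕ × ℕ) × ((ℕ × ℕ × ℕ) × (ℕ × ℕ × ℕ)) => q.1.2.1) :=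
      Primrec.fst.comp (Primrec.snd.comp Primrec.fst)
    have d : Primrec (fun q : (ℕ × ℕ × ℕ) × ((ℕ × ℕ × ℕ) × (ℕ × ℕ × ℕ)) => q.1.2.2 + 1) :=
      Primrec.succ.comp (Primrec.snd.comp (Primrec.snd.comp Primrec.fst))
    have k : Primrec (fun q : (ℕ × ℕ × ℕ) × ((ℕ × ℕ × ℕ) × (ℕ × ℕ × ℕ)) => q.2.2.2.1 + 1) :=
      Primrec.succ.comp (Primrec.fst.comp (Primrec.snd.comp (Primrec.snd.comp Primrec.snd)))
    have m : Primrec (fun q : (ℕ × ℕ × ℕ) × ((ℕ × ℕ × ℕ) × (ℕ × ℕ × ℕ)) => q.2.2.2.2 + 1) :=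
      Primrec.succ.comp (Primrec.snd.comp (Primrec.snd.comp (Primrec.snd.comp Primrec.snd)))
    have k' : Primrec (fun q : (ℕ × ℕ × ℕ) × ((ℕ × ℕ × ℕ) × (ℕ × ℕ × ℕ)) => q.2.1.2.1 + 1) :=
      Primrec.succ.comp (Primrec.fst.comp (Primrec.snd.comp (Primrec.fst.comp Primrec.snd)))
    have m' : Primrec (fun q : (ℕ × ℕ × ℕ) × ((ℕ × ℕ × ℕ) × (ℕ × ℕ × ℕ)) => q.2.1.2.2 + 1) :=
      Primrec.succ.comp (Primrec.snd.comp (Primrec.snd.comp (Primrec.fst.comp Primrec.snd)))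
    have mul := @Primrec.nat_mul
    have add := @Primrec.nat_add
    exact Primrec.nat_lt.comp
      (mul.comp (add.comp (mul.comp a m) (mul.comp (mul.comp (Primrec.const 4) k) d)) m')
      (add.comp (mul.comp (mul.comp k' d) m) (mul.comp (mul.comp b m) m'))
  set E : (ℕ × ℕ × ℕ) × (ℕ × ℕ × ℕ) → Prop := fun q =>
    (ratOfCode (cc q) : ℝ) + 4 * (((q.2.2.1 : ℝ) + 1) / (q.2.2.2 + 1)) <
      ((q.1.2.1 : ℝ) + 1) / (q.1.2.2 + 1) with hE
  have hre : REPred E := by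
    have h1 : ComputablePred E := by
      obtain ⟨hdec, hp⟩ := hprim
      have h2 := hp.to_comp.comp (hccc.pair Computable.id)
      refine ⟨fun q => decidable_of_iff _ (ratOfCode_add_lt_iff (cc q) _ _ _ _).symm,
        h2.of_eq fun q => ?_⟩
      exact decide_eq_decide.2 (ratOfCode_add_lt_iff (cc q) _ _ _ _).symm
    exact h1.to_re
  have happrox : ∀ q, |(ratOfCode (cc q) : ℝ) - dist (ComputableMetricSpace.ideal
      (h (q.2.1, q.2.2.2)) : Y) (ComputableMetricSpace.ideal q.1.1)| < 1 / ((q.2.2.2 : ℝ) + 1) := by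
    intro q
    have := hD (h (q.2.1, q.2.2.2), q.1.1) q.2.2.2
    rw [hDc] at this
    exact this.trans_le (inv_two_pow_le_one_div _)
  refine ⟨E, hre, fun b => ?_⟩
  ext x
  simp only [Set.mem_preimage, Set.mem_iUnion, idealBall, Metric.mem_ball, exists_prop]
  constructor
  · intro hx
    -- With r = 1/(m + 1), the true distance is overestimated by at most 4r and the criterion
    -- demands another 4r; hence the 8.
    obtain ⟨m, hm⟩ := exists_nat_one_div_lt (show 0 < ((b.2.1 + 1 : ℝ) / (b.2.2 + 1) -
      dist (f x) (ComputableMetricSpace.ideal b.1)) / 8 by linarith)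
    have hm0 : (0 : ℝ) < 1 / (m + 1) := by positivity
    obtain ⟨i, hi⟩ := Metric.denseRange_iff.1 (ComputableMetricSpace.dense_ideal (X := X)) x _ hm0
    refine ⟨(i, 0, m), ?_, by simpa using hi⟩
    have h1 := abs_lt.1 (happrox (b, (i, 0, m)))
    have h2 := hhf i m
    have h3 := hL.dist_le_mul (ComputableMetricSpace.ideal i) x
    rw [dist_comm _ x] at h3
    have h4 := dist_triangle4 (ComputableMetricSpace.ideal (h (i, m)) : Y)
      (f (ComputableMetricSpace.ideal i)) (f x) (ComputableMetricSpace.ideal b.1)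
    simp only [NNReal.coe_ofNat] at h3
    simp only [hE, Nat.cast_zero, zero_add]
    simp only at h1
    linarith [h1.2]
  · rintro ⟨⟨i, k, m⟩, hEq, hx⟩
    have h1 := abs_lt.1 (happrox (b, (i, k, m)))
    have h2 := hhf i m
    have h3 := hL.dist_le_mul x (ComputableMetricSpace.ideal i)
    have h4 := dist_triangle4 (f x) (f (ComputableMetricSpace.ideal i))
      (ComputableMetricSpace.ideal (h (i, m)) : Y) (ComputableMetricSpace.ideal b.1)
    rw [dist_comm (f (ComputableMetricSpace.ideal i))] at h4
    have h5 : 1 / ((m : ℝ) + 1) ≤ ((k : ℝ) + 1) / (m + 1) := by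
      gcongr
      linarith [Nat.cast_nonneg (α := ℝ) k]
    simp only [NNReal.coe_ofNat] at h3
    simp only [hE] at hEq
    simp only at h1 hx
    linarith [h1.1]

theorem ComputableOnIdeal.prodMap {X Y X' Y' : Type*} [MetricSpace X] [ComputableMetricSpace X]
    [MetricSpace Y] [ComputableMetricSpace Y] [MetricSpace X'] [ComputableMetricSpace X']
    [MetricSpace Y'] [ComputableMetricSpace Y'] {f : X → Y} {g : X' → Y'}
    (hf : ComputableOnIdeal f) (hg : ComputableOnIdeal g) : ComputableOnIdeal (Prod.map f g) := by
  obtain ⟨h, hh, hhf⟩ := hf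
  obtain ⟨k, hk, hkg⟩ := hg
  refine ⟨fun q => Nat.pair (h (q.1.unpair.1, q.2)) (k (q.1.unpair.2, q.2)), ?_, fun i n => ?_⟩
  · have u : Computable (fun q : ℕ × ℕ => q.1.unpair) := Computable.unpair.comp Computable.fst
    exact Primrec₂.natPair.to_comp.comp
      (hh.comp ((Computable.fst.comp u).pair Computable.snd))
      (hk.comp ((Computable.snd.comp u).pair Computable.snd))
  · rw [Prod.dist_eq]
    simp only [ComputableMetricSpace.ideal, Nat.unpair_pair, Prod.map_fst, Prod.map_snd]
    exact max_le (hhf _ _) (hkg _ _)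

theorem ideal_circle (i : ℕ) : (ComputableMetricSpace.ideal i : UnitAddCircle) =
    (((i.unpair.1 : ℝ) / (i.unpair.2 + 1) : ℝ) : UnitAddCircle) := rfl

theorem lipschitzWith_doublingMap : LipschitzWith 2 doublingMap := by
  refine LipschitzWith.of_dist_le_mul fun x y => ?_
  rw [doublingMap, doublingMap, dist_eq_norm, ← smul_sub, dist_eq_norm]
  exact (norm_nsmul_le (n := 2)).trans (by simp)

theorem computableOnIdeal_doublingMap : ComputableOnIdeal doublingMap := by
  refine ⟨fun q => Nat.pair (2 * q.1.unpair.1) q.1.unpair.2, ?_, fun i n => ?_⟩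
  · have u : Primrec (fun q : ℕ × ℕ => q.1.unpair) := Primrec.unpair.comp Primrec.fst
    exact (Primrec₂.natPair.comp (Primrec.nat_double.comp (Primrec.fst.comp u))
      (Primrec.snd.comp u)).to_comp
  · have : (ComputableMetricSpace.ideal (Nat.pair (2 * i.unpair.1) i.unpair.2) : UnitAddCircle) =
        doublingMap (ComputableMetricSpace.ideal i) := by
      rw [doublingMap, ideal_circle, ideal_circle, Nat.unpair_pair, ← AddCircle.coe_nsmul,
        nsmul_eq_mul]
      push_cast
      rw [mul_div_assoc]
    simp only [this, dist_self]
    positivity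

/-! ### The speed vanishing outside a recursively enumerable union of balls -/

section Speed

variable (w : ℕ → Option ℕ) (R : ℕ → ℕ)

/-- The contribution of the `t`-th ball (centre: the ideal point `w t`, radius: `1 / R t`) to the
speed. -/
noncomputable def bump (t : ℕ) (x : UnitAddCircle) : ℝ :=
  (w t).elim 0 fun j =>
    max 0 (1 / (R t : ℝ) - dist x (ComputableMetricSpace.ideal j)) / ((t : ℝ) + 2)

/-- The supremum of the bumps over all balls. -/
noncomputable def speed (x : UnitAddCircle) : ℝ := ⨆ t, bump w R t x

/-- The maximum of the first `n` bumps. -/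
noncomputable def speedUpTo (x : UnitAddCircle) (n : ℕ) : ℝ :=
  Nat.rec 0 (fun t s => max s (bump w R t x)) n

variable {w R}

theorem bump_nonneg (t : ℕ) (x : UnitAddCircle) : 0 ≤ bump w R t x := by
  unfold bump
  cases w t with
  | none => exact le_rfl
  | some j => exact div_nonneg (le_max_left _ _) (by positivity)

theorem bump_le (t : ℕ) (x : UnitAddCircle) : bump w R t x ≤ 1 / ((t : ℝ) + 2) := by
  unfold bump
  cases w t with
  | none => simp only [Option.elim]; positivity
  | some j =>
    simp only [Option.elim]
    gcongr
    refine max_le zero_le_one ?_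
    have h1 : 1 / (R t : ℝ) ≤ 1 := by
      rw [one_div]
      exact Nat.cast_inv_le_one _
    linarith [dist_nonneg (x := x) (y := ComputableMetricSpace.ideal j)]

/-- The weight 1/(t + 2) ≤ 1/2 makes each bump 1/2-Lipschitz, a bound that survives the supremum and
yields `isDriftBefore_speed`. -/
theorem bump_le_add (t : ℕ) (x y : UnitAddCircle) :
    bump w R t x ≤ bump w R t y + dist x y / 2 := by
  unfold bump
  cases w t with
  | none =>
    simp only [Option.elim, zero_add]
    positivity
  | some j =>
    simp only [Option.elim]
    set A := 1 / (R t : ℝ)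
    have h1 := dist_triangle y x (ComputableMetricSpace.ideal j : UnitAddCircle)
    rw [dist_comm y x] at h1
    have h2 : max 0 (A - dist x (ComputableMetricSpace.ideal j)) ≤
        max 0 (A - dist y (ComputableMetricSpace.ideal j)) + dist x y := by
      refine max_le (add_nonneg (le_max_left _ _) dist_nonneg) ?_
      linarith [le_max_right 0 (A - dist y (ComputableMetricSpace.ideal j : UnitAddCircle))]
    have ht : (0 : ℝ) < t + 2 := by positivity
    calc _ ≤ (max 0 (A - dist y (ComputableMetricSpace.ideal j)) + dist x y) / ((t : ℝ) + 2) := by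
          gcongr
      _ = max 0 (A - dist y (ComputableMetricSpace.ideal j)) / ((t : ℝ) + 2) +
          dist x y / ((t : ℝ) + 2) := add_div _ _ _
      _ ≤ _ := by
          gcongr
          linarith [Nat.cast_nonneg (α := ℝ) t]

theorem bddAbove_bump (x : UnitAddCircle) : BddAbove (Set.range fun t => bump w R t x) := by
  refine ⟨1, ?_⟩
  rintro _ ⟨t, rfl⟩
  refine (bump_le t x).trans ?_
  rw [div_le_one (by positivity)]
  linarith [Nat.cast_nonneg (α := ℝ) t]

theorem bump_le_speed (t : ℕ) (x : UnitAddCircle) : bump w R t x ≤ speed w R x :=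
  le_ciSup (bddAbove_bump x) t

theorem speed_nonneg (x : UnitAddCircle) : 0 ≤ speed w R x :=
  (bump_nonneg 0 x).trans (bump_le_speed 0 x)

theorem speed_le_add (x y : UnitAddCircle) : speed w R x ≤ speed w R y + dist x y / 2 :=
  ciSup_le fun t => (bump_le_add t x y).trans (by gcongr; exact bump_le_speed t y)

theorem abs_speed_sub_le (x y : UnitAddCircle) : |speed w R x - speed w R y| ≤ dist x y / 2 := by
  have h1 := speed_le_add (w := w) (R := R) x y
  have h2 := speed_le_add (w := w) (R := R) y x
  rw [dist_comm] at h2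
  rw [abs_le]
  constructor <;> linarith

theorem isDriftBefore_speed {a : ℝ} (ha : speed w R (a : UnitAddCircle) = 0) :
    IsDriftBefore (speed w R) a := fun x =>
  ⟨speed_nonneg x, by simpa [ha] using speed_le_add (w := w) (R := R) x a⟩

theorem continuous_speed : Continuous (speed w R) := by
  refine (LipschitzWith.of_dist_le_mul (K := 1) fun x y => ?_).continuous
  rw [Real.dist_eq, NNReal.coe_one, one_mul]
  linarith [abs_speed_sub_le (w := w) (R := R) x y, dist_nonneg (x := x) (y := y)]

theorem lipschitzWith_driftMap_speed : LipschitzWith 2 (driftMap (speed w R)) := by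
  refine LipschitzWith.of_dist_le_mul fun x y => ?_
  have h1 : dist ((speed w R x : ℝ) : UnitAddCircle) ((speed w R y : ℝ) : UnitAddCircle) ≤
      dist x y / 2 := by
    rw [dist_eq_norm, ← AddCircle.coe_sub]
    exact (UnitAddCircle.norm_coe_le _).trans (abs_speed_sub_le x y)
  have h2 := dist_add_add_le x ((speed w R x : ℝ) : UnitAddCircle) y
    ((speed w R y : ℝ) : UnitAddCircle)
  rw [NNReal.coe_ofNat]
  unfold driftMap
  linarith [dist_nonneg (x := x) (y := y)]

theorem speed_pos_of_dist_lt {t j : ℕ} {x : UnitAddCircle} (hj : w t = some j)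
    (hx : dist x (ComputableMetricSpace.ideal j) < 1 / (R t : ℝ)) : 0 < speed w R x := by
  refine lt_of_lt_of_le ?_ (bump_le_speed t x)
  rw [bump, hj]
  exact div_pos (lt_max_of_lt_right (sub_pos.2 hx)) (by positivity)

theorem speed_eq_zero {x : UnitAddCircle} (h : ∀ t j, w t = some j →
    1 / (R t : ℝ) ≤ dist x (ComputableMetricSpace.ideal j)) : speed w R x = 0 := by
  have : ∀ t, bump w R t x = 0 := by
    intro t
    rw [bump]
    cases hj : w t with
    | none => rfl
    | some j =>
      simp only [Option.elim]
      rw [max_eq_left (sub_nonpos.2 (h t j hj)), zero_div]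
  simp [speed, this]

/-! ### Finite approximations of the speed -/

theorem speedUpTo_le_speed (x : UnitAddCircle) (n : ℕ) : speedUpTo w R x n ≤ speed w R x := by
  induction n with
  | zero => exact speed_nonneg x
  | succ n ih => exact max_le ih (bump_le_speed n x)

theorem bump_le_speedUpTo (x : UnitAddCircle) {t n : ℕ} (h : t < n) :
    bump w R t x ≤ speedUpTo w R x n := by
  induction n with
  | zero => omega
  | succ n ih =>
    rcases Nat.lt_succ_iff_lt_or_eq.1 h with h' | rfl
    · exact (ih h').trans (le_max_left _ _)
    · exact le_max_right _ _

theorem speedUpTo_nonneg (x : UnitAddCircle) (n : ℕ) : 0 ≤ speedUpTo w R x n := by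
  cases n with
  | zero => exact le_rfl
  | succ n => exact (bump_nonneg n x).trans (le_max_right _ _)

/-- The decaying weights give an explicit bound on the omitted bumps, so the speed is computable
although U is only enumerable. -/
theorem speed_le_speedUpTo_add (x : UnitAddCircle) (n : ℕ) :
    speed w R x ≤ speedUpTo w R x n + 1 / ((n : ℝ) + 1) := by
  refine ciSup_le fun t => ?_
  rcases lt_or_ge t n with h | h
  · have : (0 : ℝ) ≤ 1 / (n + 1) := by positivity
    linarith [bump_le_speedUpTo (w := w) (R := R) x h]
  · have h1 : 1 / ((t : ℝ) + 2) ≤ 1 / ((n : ℝ) + 1) := by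
      have : (n : ℝ) ≤ t := by exact_mod_cast h
      exact one_div_le_one_div_of_le (by positivity) (by linarith)
    linarith [bump_le (w := w) (R := R) t x, speedUpTo_nonneg (w := w) (R := R) x n]

/-- The code of `max 0 (1 / r - d) / (t + 2)`, where `d` is the nonnegative rational with code
`(p.1.1, 0, p.1.2.2)`, and `(r, t) = p.2`. -/
def scaledGapCode (p : (ℕ × ℕ × ℕ) × (ℕ × ℕ)) : ℕ × ℕ × ℕ :=
  (p.1.2.2 + 1 - p.1.1 * p.2.1, 0, p.2.1 * (p.1.2.2 + 1) * (p.2.2 + 2) - 1)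

theorem primrec_scaledGapCode : Primrec scaledGapCode := by
  have a : Primrec (fun p : (ℕ × ℕ × ℕ) × (ℕ × ℕ) => p.1.1) := Primrec.fst.comp Primrec.fst
  have d : Primrec (fun p : (ℕ × ℕ × ℕ) × (ℕ × ℕ) => p.1.2.2 + 1) :=
    Primrec.succ.comp (Primrec.snd.comp (Primrec.snd.comp Primrec.fst))
  have r : Primrec (fun p : (ℕ × ℕ × ℕ) × (ℕ × ℕ) => p.2.1) := Primrec.fst.comp Primrec.snd
  have t : Primrec (fun p : (ℕ × ℕ × ℕ) × (ℕ × ℕ) => p.2.2 + 2) :=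
    Primrec.succ.comp (Primrec.succ.comp (Primrec.snd.comp Primrec.snd))
  have mul := @Primrec.nat_mul
  exact (Primrec.nat_sub.comp d (mul.comp a r)).pair ((Primrec.const 0).pair
    (Primrec.nat_sub.comp (mul.comp (mul.comp r d) t) (Primrec.const 1)))

variable (w R) in
/-- The code of the value of the `t`-th bump at the `i`-th ideal point. -/
def bumpCode (i t : ℕ) : ℕ × ℕ × ℕ :=
  Option.casesOn (w t) (0, 0, 0) fun j =>
    scaledGapCode (circleDistCode (i.unpair, j.unpair), (R t, t))

variable (w R) in
/-- The code of the maximum of the first `n` bumps at the `i`-th ideal point. -/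
def speedCode (i n : ℕ) : ℕ × ℕ × ℕ :=
  Nat.rec (0, 0, 0) (fun t c => maxCode (c, bumpCode w R i t)) n

theorem bumpCode_snd_fst (i t : ℕ) : (bumpCode w R i t).2.1 = 0 := by
  unfold bumpCode
  cases w t <;> rfl

theorem ratOfCode_bumpCode (hR : ∀ t, 0 < R t) (i t : ℕ) :
    (ratOfCode (bumpCode w R i t) : ℝ) = bump w R t (ComputableMetricSpace.ideal i) := by
  unfold bumpCode bump
  cases w t with
  | none => simp [ratOfCode]
  | some j =>
    have h := ratOfCode_circleDistCode i.unpair.1 i.unpair.2 j.unpair.1 j.unpair.2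
    simp only [Prod.mk.eta] at h
    rw [← ideal_circle, ← ideal_circle] at h
    simp only [Option.elim]
    rw [← h]
    have h0 : (circleDistCode (i.unpair, j.unpair)).2.1 = 0 := rfl
    set c := circleDistCode (i.unpair, j.unpair)
    have hRt : (0 : ℝ) < R t := by exact_mod_cast hR t
    have hpos : 0 < R t * (c.2.2 + 1) * (t + 2) := by
      have := hR t
      positivity
    have hden : ((R t * (c.2.2 + 1) * (t + 2) - 1 : ℕ) : ℝ) + 1 =
        R t * (c.2.2 + 1) * (t + 2) := by
      have : R t * (c.2.2 + 1) * (t + 2) - 1 + 1 = R t * (c.2.2 + 1) * (t + 2) :=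
        Nat.sub_add_cancel hpos
      exact_mod_cast this
    have hnum : ((c.2.2 + 1 - c.1 * R t : ℕ) : ℝ) = max 0 ((c.2.2 : ℝ) + 1 - c.1 * R t) := by
      rcases le_total (c.1 * R t) (c.2.2 + 1) with hle | hle
      · rw [Nat.cast_sub hle]
        have : (c.1 : ℝ) * R t ≤ c.2.2 + 1 := by exact_mod_cast hle
        push_cast
        rw [max_eq_right (by linarith)]
      · rw [Nat.sub_eq_zero_of_le hle]
        have : (c.2.2 : ℝ) + 1 ≤ c.1 * R t := by exact_mod_cast hle
        rw [max_eq_left (by linarith)]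
        simp
    have hval : 1 / (R t : ℝ) - ((c.1 : ℝ) - 0) / (c.2.2 + 1) =
        ((c.2.2 : ℝ) + 1 - c.1 * R t) / (R t * (c.2.2 + 1)) := by
      field_simp
      ring
    unfold ratOfCode scaledGapCode
    push_cast
    rw [hden, hnum, h0, Nat.cast_zero, hval, ← div_div, sub_zero]
    congr 1
    have hd : (0 : ℝ) < R t * (c.2.2 + 1) := by positivity
    rw [← max_div_div_right hd.le, zero_div]

theorem ratOfCode_speedCode (hR : ∀ t, 0 < R t) (i n : ℕ) :
    (ratOfCode (speedCode w R i n) : ℝ) = speedUpTo w R (ComputableMetricSpace.ideal i) n := by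
  induction n with
  | zero => simp [speedCode, speedUpTo, ratOfCode]
  | succ n ih =>
    have h1 : speedCode w R i (n + 1) = maxCode (speedCode w R i n, bumpCode w R i n) := rfl
    rw [h1, ratOfCode_maxCode, Rat.cast_max, ih, ratOfCode_bumpCode hR]
    rfl

theorem speedCode_snd_fst (i n : ℕ) : (speedCode w R i n).2.1 = 0 := by
  induction n with
  | zero => rfl
  | succ n ih =>
    have h1 : speedCode w R i (n + 1) = maxCode (speedCode w R i n, bumpCode w R i n) := rfl
    rw [h1, maxCode]
    split_ifs
    · exact bumpCode_snd_fst i n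
    · exact ih

theorem computable_bumpCode (hw : Computable w) (hR : Computable R) :
    Computable (fun q : ℕ × ℕ => bumpCode w R q.1 q.2) := by
  have pd : Primrec (fun q : ℕ × ℕ => circleDistCode (q.1.unpair, q.2.unpair)) :=
    primrec_circleDistCode.comp ((Primrec.unpair.comp Primrec.fst).pair
      (Primrec.unpair.comp Primrec.snd))
  have j : Computable (fun q : (ℕ × ℕ) × ℕ => (q.1.1, q.2)) :=
    (Computable.fst.comp Computable.fst).pair Computable.snd
  have cd := pd.to_comp.comp j
  have t : Computable (fun q : (ℕ × ℕ) × ℕ => q.1.2) := Computable.snd.comp Computable.fst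
  have h := primrec_scaledGapCode.to_comp.comp (cd.pair ((hR.comp t).pair t))
  have h2 : Computable₂ (fun (q : ℕ × ℕ) (j : ℕ) =>
      scaledGapCode (circleDistCode (q.1.unpair, j.unpair), (R q.2, q.2))) := h.to₂
  exact (Computable.option_casesOn (hw.comp Computable.snd)
    (Computable.const ((0, 0, 0) : ℕ × ℕ × ℕ)) h2).of_eq fun q => rfl

theorem computable_speedCode (hw : Computable w) (hR : Computable R) :
    Computable (fun q : ℕ × ℕ => speedCode w R q.1 q.2) := by
  have i : Computable (fun p : (ℕ × ℕ) × (ℕ × (ℕ × ℕ × ℕ)) => p.1.1) :=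
    Computable.fst.comp Computable.fst
  have t : Computable (fun p : (ℕ × ℕ) × (ℕ × (ℕ × ℕ × ℕ)) => p.2.1) :=
    Computable.fst.comp Computable.snd
  have c : Computable (fun p : (ℕ × ℕ) × (ℕ × (ℕ × ℕ × ℕ)) => p.2.2) :=
    Computable.snd.comp Computable.snd
  have b := (computable_bumpCode hw hR).comp (i.pair t)
  have h : Computable₂ (fun (q : ℕ × ℕ) (p : ℕ × (ℕ × ℕ × ℕ)) =>
      maxCode (p.2, bumpCode w R q.1 p.1)) := primrec_maxCode.to_comp.comp (c.pair b)
  exact (Computable.nat_rec Computable.snd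
    (Computable.const ((0, 0, 0) : ℕ × ℕ × ℕ)) h).of_eq fun q => rfl

theorem computableOnIdeal_driftMap_speed (hw : Computable w) (hR : Computable R)
    (hR0 : ∀ t, 0 < R t) : ComputableOnIdeal (driftMap (speed w R)) := by
  -- The code of the sum of the ideal point and the truncated speed over their common denominator;
  -- codes store denominators minus one.
  refine ⟨fun q => Nat.pair
    (q.1.unpair.1 * ((speedCode w R q.1 q.2).2.2 + 1) +
      (speedCode w R q.1 q.2).1 * (q.1.unpair.2 + 1))
    ((q.1.unpair.2 + 1) * ((speedCode w R q.1 q.2).2.2 + 1) - 1), ?_, fun i n => ?_⟩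
  · have hp : Primrec (fun q : (ℕ × ℕ) × (ℕ × ℕ × ℕ) =>
        Nat.pair (q.1.1 * (q.2.2.2 + 1) + q.2.1 * (q.1.2 + 1)) ((q.1.2 + 1) * (q.2.2.2 + 1) - 1)) := by
      have a : Primrec (fun q : (ℕ × ℕ) × (ℕ × ℕ × ℕ) => q.1.1) := Primrec.fst.comp Primrec.fst
      have b : Primrec (fun q : (ℕ × ℕ) × (ℕ × ℕ × ℕ) => q.1.2 + 1) :=
        Primrec.succ.comp (Primrec.snd.comp Primrec.fst)
      have c : Primrec (fun q : (ℕ × ℕ) × (ℕ × ℕ × ℕ) => q.2.1) := Primrec.fst.comp Primrec.snd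
      have e : Primrec (fun q : (ℕ × ℕ) × (ℕ × ℕ × ℕ) => q.2.2.2 + 1) :=
        Primrec.succ.comp (Primrec.snd.comp (Primrec.snd.comp Primrec.snd))
      have mul := @Primrec.nat_mul
      exact Primrec₂.natPair.comp (Primrec.nat_add.comp (mul.comp a e) (mul.comp c b))
        (Primrec.nat_sub.comp (mul.comp b e) (Primrec.const 1))
    have u : Computable (fun q : ℕ × ℕ => q.1.unpair) := Computable.unpair.comp Computable.fst
    exact (hp.to_comp.comp (u.pair (computable_speedCode hw hR))).of_eq fun q => rfl
  · have hc := ratOfCode_speedCode (w := w) hR0 i n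
    have hc0 := speedCode_snd_fst (w := w) (R := R) i n
    simp only
    set c := speedCode w R i n
    set s := speedUpTo w R (ComputableMetricSpace.ideal i) n
    have hs : s = (c.1 : ℝ) / (c.2.2 + 1) := by
      rw [← hc, ratOfCode, hc0]
      push_cast
      rw [sub_zero]
    have hden : (((i.unpair.2 + 1) * (c.2.2 + 1) - 1 : ℕ) : ℝ) + 1 =
        ((i.unpair.2 : ℝ) + 1) * (c.2.2 + 1) := by
      have : (i.unpair.2 + 1) * (c.2.2 + 1) - 1 + 1 = (i.unpair.2 + 1) * (c.2.2 + 1) :=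
        Nat.sub_add_cancel (Nat.mul_pos (Nat.succ_pos _) (Nat.succ_pos _))
      exact_mod_cast this
    have hpt : (ComputableMetricSpace.ideal (Nat.pair
        (i.unpair.1 * (c.2.2 + 1) + c.1 * (i.unpair.2 + 1))
        ((i.unpair.2 + 1) * (c.2.2 + 1) - 1)) : UnitAddCircle) =
        ComputableMetricSpace.ideal i + (s : ℝ) := by
      rw [ideal_circle, ideal_circle, Nat.unpair_pair, ← AddCircle.coe_add, hs]
      simp only
      rw [hden]
      congr 1
      push_cast
      field_simp
    rw [hpt, driftMap, dist_add_left, dist_eq_norm, ← AddCircle.coe_sub]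
    refine (UnitAddCircle.norm_coe_le _).trans ?_
    rw [abs_sub_comm, abs_of_nonneg (sub_nonneg.2 (speedUpTo_le_speed _ n))]
    linarith [speed_le_speedUpTo_add (w := w) (R := R) (ComputableMetricSpace.ideal i) n]

end Speed

/-! ### Computable measures -/

section Wasserstein

variable {X : Type*} [MetricSpace X] [CompactSpace X] [MeasurableSpace X]

theorem integrable_of_lipschitzWith [BorelSpace X] {K : NNReal} {f : X → ℝ} (hf : LipschitzWith K f)
    (μ : Measure X) [IsFiniteMeasure μ] : Integrable f μ :=
  hf.continuous.integrable_of_hasCompactSupport (HasCompactSupport.of_compactSpace f)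

/-- Both integrals are within the diameter of f(x₀). This bounds the family defining
`wassersteinDist`, so that its real supremum is not the default value. -/
theorem abs_integral_sub_integral_le_diam [BorelSpace X] (μ ν : ProbabilityMeasure X) {f : X → ℝ}
    (hf : LipschitzWith 1 f) :
    |(∫ x, f x ∂(μ : Measure X)) - ∫ x, f x ∂(ν : Measure X)| ≤
      2 * Metric.diam (Set.univ : Set X) := by
  obtain ⟨x₀⟩ : Nonempty X := nonempty_of_isProbabilityMeasure (μ : Measure X)
  have key : ∀ ρ : ProbabilityMeasure X,
      |(∫ x, f x ∂(ρ : Measure X)) - f x₀| ≤ Metric.diam (Set.univ : Set X) := by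
    intro ρ
    have h1 : (∫ x, f x ∂(ρ : Measure X)) - f x₀ = ∫ x, (f x - f x₀) ∂(ρ : Measure X) := by
      rw [integral_sub (integrable_of_lipschitzWith hf _) (integrable_const _)]
      simp
    rw [h1, ← Real.norm_eq_abs]
    refine (norm_integral_le_of_norm_le_const (C := Metric.diam (Set.univ : Set X))
      (Eventually.of_forall fun x => ?_)).trans (by simp)
    rw [← dist_eq_norm]
    refine (hf.dist_le_mul x x₀).trans ?_
    rw [NNReal.coe_one, one_mul]
    exact Metric.dist_le_diam_of_mem isCompact_univ.isBounded trivial trivial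
  have h1 := abs_le.1 (key μ)
  have h2 := abs_le.1 (key ν)
  rw [abs_le]
  constructor <;> linarith [h1.1, h1.2, h2.1, h2.2]

theorem abs_integral_sub_integral_le_wassersteinDist [BorelSpace X] (μ ν : ProbabilityMeasure X) {f : X → ℝ}
    (hf : LipschitzWith 1 f) :
    |(∫ x, f x ∂(μ : Measure X)) - ∫ x, f x ∂(ν : Measure X)| ≤ wassersteinDist μ ν := by
  refine le_ciSup (f := fun f : {f : X → ℝ // LipschitzWith 1 f} =>
    |(∫ x, f.1 x ∂(μ : Measure X)) - ∫ x, f.1 x ∂(ν : Measure X)|) ?_ ⟨f, hf⟩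
  refine ⟨2 * Metric.diam (Set.univ : Set X), ?_⟩
  rintro _ ⟨g, rfl⟩
  exact abs_integral_sub_integral_le_diam μ ν g.2

theorem wassersteinDist_le (μ ν : ProbabilityMeasure X) {C : ℝ}
    (h : ∀ f : X → ℝ, LipschitzWith 1 f →
      |(∫ x, f x ∂(μ : Measure X)) - ∫ x, f x ∂(ν : Measure X)| ≤ C) :
    wassersteinDist μ ν ≤ C := by
  have : Nonempty {f : X → ℝ // LipschitzWith 1 f} := ⟨⟨fun _ => 0, LipschitzWith.const' 0⟩⟩
  exact ciSup_le fun f => h f.1 f.2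

end Wasserstein

theorem coe_idealMeasure_singleton {X : Type*} [MetricSpace X] [ComputableMetricSpace X]
    [MeasurableSpace X] (i : ℕ) : (idealMeasure X ((0, i), []) : Measure X) =
      Measure.dirac (ComputableMetricSpace.ideal i) := by
  show ((([(0, i)] : List (ℕ × ℕ)).map fun a => ((a.1 : ℝ≥0∞) + 1)).sum)⁻¹ •
    idealSum X [(0, i)] = _
  simp [idealSum]

theorem IsComputablePoint.isComputableMeasure_dirac {X : Type*} [MetricSpace X] [CompactSpace X]
    [ComputableMetricSpace X] [MeasurableSpace X] [BorelSpace X] {x : X}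
    (hx : IsComputablePoint x) {δ : ProbabilityMeasure X} (hδ : (δ : Measure X) = Measure.dirac x) :
    IsComputableMeasure δ := by
  obtain ⟨f, hf, hfx⟩ := hx
  refine ⟨fun n => ((0, f n), []), ((Computable.const 0).pair hf).pair (Computable.const []),
    fun n => lt_of_le_of_lt (wassersteinDist_le _ _ fun φ hφ => ?_) (hfx n)⟩
  rw [coe_idealMeasure_singleton, hδ, integral_dirac, integral_dirac, ← Real.dist_eq]
  simpa using hφ.dist_le_mul (ComputableMetricSpace.ideal (f n)) x

section Fst

variable {X Y : Type*} [MetricSpace X] [ComputableMetricSpace X] [MeasurableSpace X]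
  [MetricSpace Y] [ComputableMetricSpace Y] [MeasurableSpace Y]

/-- The first marginal of a coded measure on a product. -/
def fstCode (p : (ℕ × ℕ) × List (ℕ × ℕ)) : (ℕ × ℕ) × List (ℕ × ℕ) :=
  ((p.1.1, p.1.2.unpair.1), p.2.map fun a => (a.1, a.2.unpair.1))

theorem primrec_fstCode : Primrec fstCode := by
  have h : Primrec (fun a : ℕ × ℕ => (a.1, a.2.unpair.1)) :=
    Primrec.fst.pair (Primrec.fst.comp (Primrec.unpair.comp Primrec.snd))
  exact (h.comp Primrec.fst).pair (Primrec.list_map Primrec.snd (h.comp Primrec.snd).to₂)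

theorem map_fst_idealSum (L : List (ℕ × ℕ)) :
    (idealSum (X × Y) L).map Prod.fst = idealSum X (L.map fun a => (a.1, a.2.unpair.1)) := by
  unfold idealSum
  induction L with
  | nil => simp
  | cons a L ih =>
    simp only [List.map_cons, List.sum_cons]
    rw [Measure.map_add _ _ measurable_fst, ih, Measure.map_smul, Measure.map_dirac' measurable_fst]
    rfl

theorem map_fst_idealMeasure (p : (ℕ × ℕ) × List (ℕ × ℕ)) :
    (idealMeasure (X × Y) p : Measure (X × Y)).map Prod.fst =
      (idealMeasure X (fstCode p) : Measure X) := by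
  show (((((p.1 :: p.2).map fun a => ((a.1 : ℝ≥0∞) + 1)).sum)⁻¹) •
    idealSum (X × Y) (p.1 :: p.2)).map Prod.fst =
    (((((fstCode p).1 :: (fstCode p).2).map fun a => ((a.1 : ℝ≥0∞) + 1)).sum)⁻¹) •
      idealSum X ((fstCode p).1 :: (fstCode p).2)
  rw [Measure.map_smul, map_fst_idealSum]
  simp [fstCode, Function.comp_def]

/-- The projection is 1-Lipschitz for the maximum distance, so it does not increase the Wasserstein
distance, and it sends coded measures to coded measures computably. -/
theorem IsComputableMeasure.map_fst [CompactSpace X] [CompactSpace Y] [BorelSpace X]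
    [BorelSpace Y] [BorelSpace (X × Y)]
    {μ : ProbabilityMeasure (X × Y)} (hμ : IsComputableMeasure μ) {ν : ProbabilityMeasure X}
    (hν : (ν : Measure X) = (μ : Measure (X × Y)).map Prod.fst) : IsComputableMeasure ν := by
  obtain ⟨f, hf, hfμ⟩ := hμ
  refine ⟨fun n => fstCode (f n), primrec_fstCode.to_comp.comp hf, fun n =>
    lt_of_le_of_lt (wassersteinDist_le _ _ fun φ hφ => ?_) (hfμ n)⟩
  rw [hν, ← map_fst_idealMeasure (Y := Y),
    integral_map measurable_fst.aemeasurable hφ.continuous.aestronglyMeasurable,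
    integral_map measurable_fst.aemeasurable hφ.continuous.aestronglyMeasurable]
  have h := hφ.comp (LipschitzWith.prod_fst (α := X) (β := Y))
  rw [one_mul] at h
  exact abs_integral_sub_integral_le_wassersteinDist _ _ h

end Fst

/-! ### Heavy arcs of coded measures -/

/-- The number of the arc `[c / 2 ^ k, (c + 1) / 2 ^ k)` that contains the `i`-th ideal point. -/
def idealArc (k i : ℕ) : ℕ := i.unpair.1 * 2 ^ k / (i.unpair.2 + 1) % 2 ^ k

/-- The total weight of a coded measure. -/
def totalWeight (L : List (ℕ × ℕ)) : ℕ := L.foldr (fun a s => a.1 + 1 + s) 0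

/-- The weight that a coded measure gives to the arc with number `c`. -/
def arcWeight (k c : ℕ) (L : List (ℕ × ℕ)) : ℕ :=
  L.foldr (fun a s => (if idealArc k a.2 = c then a.1 + 1 else 0) + s) 0

theorem primrec_two_pow : Primrec (fun k : ℕ => 2 ^ k) := by
  have h : Primrec₂ (fun (_ : ℕ) (p : ℕ × ℕ) => 2 * p.2) :=
    Primrec.nat_double.comp (Primrec.snd.comp Primrec.snd)
  refine (Primrec.nat_rec' Primrec.id (Primrec.const 1) h).of_eq fun n => ?_
  induction n with
  | zero => rfl
  | succ n ih =>
    rw [pow_succ', ← ih]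
    rfl

theorem primrec_idealArc : Primrec₂ idealArc := by
  have p : Primrec (fun q : ℕ × ℕ => 2 ^ q.1) := primrec_two_pow.comp Primrec.fst
  have u : Primrec (fun q : ℕ × ℕ => q.2.unpair) := Primrec.unpair.comp Primrec.snd
  exact Primrec.nat_mod.comp (Primrec.nat_div.comp
    (Primrec.nat_mul.comp (Primrec.fst.comp u) p) (Primrec.succ.comp (Primrec.snd.comp u))) p

theorem primrec_totalWeight : Primrec totalWeight := by
  have h : Primrec₂ (fun (_ : List (ℕ × ℕ)) (p : (ℕ × ℕ) × ℕ) => p.1.1 + 1 + p.2) :=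
    Primrec.nat_add.comp (Primrec.succ.comp (Primrec.fst.comp (Primrec.fst.comp Primrec.snd)))
      (Primrec.snd.comp Primrec.snd)
  exact Primrec.list_foldr Primrec.id (Primrec.const 0) h

theorem primrec_arcWeight :
    Primrec (fun q : (ℕ × ℕ) × List (ℕ × ℕ) => arcWeight q.1.1 q.1.2 q.2) := by
  have h : Primrec₂ (fun (q : (ℕ × ℕ) × List (ℕ × ℕ)) (p : (ℕ × ℕ) × ℕ) =>
      (if idealArc q.1.1 p.1.2 = q.1.2 then p.1.1 + 1 else 0) + p.2) := by
    have k : Primrec (fun r : ((ℕ × ℕ) × List (ℕ × ℕ)) × ((ℕ × ℕ) × ℕ) => r.1.1.1) :=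
      Primrec.fst.comp (Primrec.fst.comp Primrec.fst)
    have c : Primrec (fun r : ((ℕ × ℕ) × List (ℕ × ℕ)) × ((ℕ × ℕ) × ℕ) => r.1.1.2) :=
      Primrec.snd.comp (Primrec.fst.comp Primrec.fst)
    have a : Primrec (fun r : ((ℕ × ℕ) × List (ℕ × ℕ)) × ((ℕ × ℕ) × ℕ) => r.2.1) :=
      Primrec.fst.comp Primrec.snd
    exact Primrec.nat_add.comp (Primrec.ite
      (Primrec.eq.comp (primrec_idealArc.comp k (Primrec.snd.comp a)) c)
      (Primrec.succ.comp (Primrec.fst.comp a)) (Primrec.const 0)) (Primrec.snd.comp Primrec.snd)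
  exact Primrec.list_foldr Primrec.snd (Primrec.const 0) h

theorem idealArc_lt (k i : ℕ) : idealArc k i < 2 ^ k := Nat.mod_lt _ (by positivity)

/-- Pigeonhole: the weights of the 2^k arcs add up to the total weight. -/
theorem exists_heavy_arc (k : ℕ) (L : List (ℕ × ℕ)) :
    ∃ c, totalWeight L ≤ arcWeight k c L * 2 ^ k := by
  have hsum : ∑ c ∈ Finset.range (2 ^ k), arcWeight k c L = totalWeight L := by
    induction L with
    | nil => simp [arcWeight, totalWeight]
    | cons a L ih =>
      have h1 : ∀ c, arcWeight k c (a :: L) =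
          (if idealArc k a.2 = c then a.1 + 1 else 0) + arcWeight k c L := fun c => rfl
      have h2 : totalWeight (a :: L) = a.1 + 1 + totalWeight L := rfl
      simp only [h1, Finset.sum_add_distrib, ih, h2, Finset.sum_ite_eq, Finset.mem_range,
        idealArc_lt, if_true]
  by_contra! hcon
  have h2 : ∑ c ∈ Finset.range (2 ^ k), arcWeight k c L * 2 ^ k <
      ∑ _c ∈ Finset.range (2 ^ k), totalWeight L :=
    Finset.sum_lt_sum_of_nonempty ⟨0, by simp⟩ fun c _ => hcon c
  rw [← Finset.sum_mul, hsum, Finset.sum_const, Finset.card_range, smul_eq_mul, mul_comm] at h2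
  exact lt_irrefl _ h2

theorem dist_ideal_idealArc_le (k i : ℕ) : dist (ComputableMetricSpace.ideal i : UnitAddCircle)
    (((idealArc k i : ℝ) / 2 ^ k : ℝ) : UnitAddCircle) ≤ 1 / 2 ^ k := by
  rw [ideal_circle]
  set a := i.unpair.1
  set b := i.unpair.2
  set q := a * 2 ^ k / (b + 1) with hq
  have hc : idealArc k i = q % 2 ^ k := rfl
  have h2 : (0 : ℝ) < 2 ^ k := by positivity
  have hb : (0 : ℝ) < (b : ℝ) + 1 := by positivity
  have hqR : (q : ℝ) = (idealArc k i : ℝ) + 2 ^ k * ((q / 2 ^ k : ℕ) : ℝ) := by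
    have := Nat.mod_add_div q (2 ^ k)
    rw [hc]
    exact_mod_cast this.symm
  have h1 : (q : ℝ) * (b + 1) ≤ a * 2 ^ k := by exact_mod_cast Nat.div_mul_le_self (a * 2 ^ k) (b + 1)
  have h3 : (a : ℝ) * 2 ^ k < (q + 1) * (b + 1) := by
    have h := Nat.lt_mul_div_succ (a * 2 ^ k) (Nat.succ_pos b)
    rw [mul_comm (Nat.succ b)] at h
    exact_mod_cast h
  -- Reduction modulo 2^k changes the real representative by an integer only.
  have e : (((idealArc k i : ℝ) / 2 ^ k : ℝ) : UnitAddCircle) = ((q : ℝ) / 2 ^ k : ℝ) := by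
    have hz : ∀ m : ℕ, ((m : ℝ) : UnitAddCircle) = 0 := fun m =>
      (AddCircle.coe_eq_zero_iff (1 : ℝ)).2 ⟨(m : ℤ), by simp⟩
    have h4 : (q : ℝ) / 2 ^ k = (idealArc k i : ℝ) / 2 ^ k + ((q / 2 ^ k : ℕ) : ℝ) := by
      rw [div_add' _ _ _ h2.ne', mul_comm, ← hqR]
    rw [h4, AddCircle.coe_add, hz, add_zero]
  rw [e, dist_eq_norm, ← AddCircle.coe_sub]
  refine (UnitAddCircle.norm_coe_le _).trans ?_
  have e2 : (a : ℝ) / (b + 1) - q / 2 ^ k = (a * 2 ^ k - q * (b + 1)) / (b + 1) / 2 ^ k := by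
    field_simp
  rw [e2, abs_div, abs_of_pos h2]
  gcongr
  rw [abs_of_nonneg (div_nonneg (by linarith) hb.le), div_le_one hb]
  linarith

theorem arcWeight_le_idealSum (k c : ℕ) (L : List (ℕ × ℕ)) : (arcWeight k c L : ℝ≥0∞) ≤
    idealSum UnitAddCircle L
      (Metric.closedBall (((c : ℝ) / 2 ^ k : ℝ) : UnitAddCircle) (1 / 2 ^ k)) := by
  unfold idealSum
  induction L with
  | nil => simp [arcWeight]
  | cons a L ih =>
    have h1 : arcWeight k c (a :: L) =
        (if idealArc k a.2 = c then a.1 + 1 else 0) + arcWeight k c L := rfl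
    rw [h1, List.map_cons, List.sum_cons, Measure.add_apply, Nat.cast_add]
    refine add_le_add ?_ ih
    split_ifs with h
    · rw [Measure.smul_apply, Measure.dirac_apply_of_mem]
      · simp
      · rw [Metric.mem_closedBall, ← h]
        exact dist_ideal_idealArc_le k a.2
    · simp

theorem natCast_totalWeight (L : List (ℕ × ℕ)) :
    (totalWeight L : ℝ≥0∞) = (L.map fun a => ((a.1 : ℝ≥0∞) + 1)).sum := by
  induction L with
  | nil => simp [totalWeight]
  | cons a L ih =>
    have h : totalWeight (a :: L) = a.1 + 1 + totalWeight L := rfl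
    rw [h, List.map_cons, List.sum_cons, ← ih]
    push_cast
    rfl

theorem le_idealMeasure_closedBall_of_heavy {k c : ℕ} {p : (ℕ × ℕ) × List (ℕ × ℕ)}
    (h : totalWeight (p.1 :: p.2) ≤ arcWeight k c (p.1 :: p.2) * 2 ^ k) :
    1 / 2 ^ k ≤ (idealMeasure UnitAddCircle p : Measure UnitAddCircle).real
      (Metric.closedBall (((c : ℝ) / 2 ^ k : ℝ) : UnitAddCircle) (1 / 2 ^ k)) := by
  set B := Metric.closedBall (((c : ℝ) / 2 ^ k : ℝ) : UnitAddCircle) (1 / 2 ^ k)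
  set S := totalWeight (p.1 :: p.2) with hS
  have hS0 : 0 < S := by
    have : S = p.1.1 + 1 + totalWeight p.2 := rfl
    omega
  have h1 : (idealMeasure UnitAddCircle p : Measure UnitAddCircle) B =
      (S : ℝ≥0∞)⁻¹ * idealSum UnitAddCircle (p.1 :: p.2) B := by
    rw [hS, natCast_totalWeight]
    rfl
  have h2 : (S : ℝ≥0∞)⁻¹ * arcWeight k c (p.1 :: p.2) ≤
      (idealMeasure UnitAddCircle p : Measure UnitAddCircle) B := by
    rw [h1]
    gcongr
    exact arcWeight_le_idealSum k c _
  have h3 := ENNReal.toReal_mono (measure_ne_top _ _) h2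
  rw [ENNReal.toReal_mul, ENNReal.toReal_inv, ENNReal.toReal_natCast, ENNReal.toReal_natCast] at h3
  refine le_trans ?_ h3
  have hS0' : (0 : ℝ) < S := by exact_mod_cast hS0
  have h' : (S : ℝ) ≤ arcWeight k c (p.1 :: p.2) * 2 ^ k := by exact_mod_cast h
  rw [inv_mul_eq_div, div_le_div_iff₀ (by positivity) hS0']
  linarith

/-! ### A small open set charged by all computable measures -/

/-- The arc of length `1 / 2 ^ k` with number `c` has at least the average weight. -/
def isHeavy (k : ℕ) (p : (ℕ × ℕ) × List (ℕ × ℕ)) (c : ℕ) : Bool :=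
  decide (totalWeight (p.1 :: p.2) ≤ arcWeight k c (p.1 :: p.2) * 2 ^ k)

theorem primrec_isHeavy : Primrec fun r : (ℕ × ((ℕ × ℕ) × List (ℕ × ℕ))) × ℕ =>
    isHeavy r.1.1 r.1.2 r.2 := by
  have L : Primrec fun r : (ℕ × ((ℕ × ℕ) × List (ℕ × ℕ))) × ℕ => r.1.2.1 :: r.1.2.2 :=
    Primrec.list_cons.comp (Primrec.fst.comp (Primrec.snd.comp Primrec.fst))
      (Primrec.snd.comp (Primrec.snd.comp Primrec.fst))
  have k : Primrec fun r : (ℕ × ((ℕ × ℕ) × List (ℕ × ℕ))) × ℕ => r.1.1 :=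
    Primrec.fst.comp Primrec.fst
  have h := Primrec.nat_le.comp (primrec_totalWeight.comp L) (Primrec.nat_mul.comp
    (primrec_arcWeight.comp ((k.pair Primrec.snd).pair L)) (primrec_two_pow.comp k))
  exact h.decide.of_eq fun r => rfl

/-- For the `e`-th program, regarded as a program for a computable measure, the number of an arc of
length `1 / 2 ^ (e + 4)` that is heavy for the approximation of precision `2 ^ (-(2e + 9))`. -/
def heavyArc (e : ℕ) : Part ℕ :=
  (Nat.Partrec.Code.eval (Denumerable.ofNat Nat.Partrec.Code e) (2 * (e + 4) + 1)).bind fun v =>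
    (Encodable.decode (α := (ℕ × ℕ) × List (ℕ × ℕ)) v : Part ((ℕ × ℕ) × List (ℕ × ℕ))).bind fun p =>
      Nat.rfind fun c => Part.some (isHeavy (e + 4) p c)

theorem partrec_heavyArc : Partrec heavyArc := by
  have h1 : Partrec fun e : ℕ => Nat.Partrec.Code.eval (Denumerable.ofNat Nat.Partrec.Code e)
      (2 * (e + 4) + 1) :=
    Nat.Partrec.Code.eval_part.comp (Computable.ofNat Nat.Partrec.Code)
      (Primrec.nat_double_succ.comp (Primrec.nat_add.comp Primrec.id (Primrec.const 4))).to_comp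
  have h2 : Partrec fun q : ℕ × ℕ => (Encodable.decode (α := (ℕ × ℕ) × List (ℕ × ℕ)) q.2 :
      Part ((ℕ × ℕ) × List (ℕ × ℕ))) :=
    (Computable.decode.comp Computable.snd).ofOption
  have k : Primrec fun r : ((ℕ × ℕ) × ((ℕ × ℕ) × List (ℕ × ℕ))) × ℕ =>
      ((r.1.1.1 + 4, r.1.2), r.2) :=
    ((Primrec.nat_add.comp (Primrec.fst.comp (Primrec.fst.comp Primrec.fst))
      (Primrec.const 4)).pair (Primrec.snd.comp Primrec.fst)).pair Primrec.snd
  have h3 : Computable₂ fun (q : (ℕ × ℕ) × ((ℕ × ℕ) × List (ℕ × ℕ))) (c : ℕ) =>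
      isHeavy (q.1.1 + 4) q.2 c :=
    ((primrec_isHeavy.comp k).to_comp.of_eq fun r => rfl).to₂
  have h4 : Partrec fun q : (ℕ × ℕ) × ((ℕ × ℕ) × List (ℕ × ℕ)) =>
      Nat.rfind fun c => Part.some (isHeavy (q.1.1 + 4) q.2 c) := Partrec.rfind h3.partrec₂
  have h5 := h2.bind h4.to₂
  exact h1.bind h5.to₂

/-- Take e to be the index of a program for `f` itself: the precision 2(e + 4) + 1 at which
`heavyArc` queries it depends on that same index. -/
theorem exists_mem_heavyArc {f : ℕ → (ℕ × ℕ) × List (ℕ × ℕ)} (hf : Computable f) :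
    ∃ e c, c ∈ heavyArc e ∧ totalWeight ((f (2 * (e + 4) + 1)).1 :: (f (2 * (e + 4) + 1)).2) ≤
      arcWeight (e + 4) c ((f (2 * (e + 4) + 1)).1 :: (f (2 * (e + 4) + 1)).2) * 2 ^ (e + 4) := by
  obtain ⟨d, hd⟩ := Nat.Partrec.Code.exists_code.1 (Partrec.nat_iff.1
    (Computable.encode.comp hf).partrec)
  set e := Encodable.encode d with he
  set p := f (2 * (e + 4) + 1) with hp
  obtain ⟨c₀, hc₀⟩ := exists_heavy_arc (e + 4) (p.1 :: p.2)
  obtain ⟨c, hc, -⟩ := Nat.rfind_min' (p := isHeavy (e + 4) p) (m := c₀)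
    (by simpa [isHeavy] using hc₀)
  refine ⟨e, c, ?_, ?_⟩
  · refine Part.mem_bind (a := Encodable.encode p) ?_ (Part.mem_bind (a := p) ?_ hc)
    · rw [he, Denumerable.ofNat_encode, hd]
      exact Part.mem_some _
    · rw [Encodable.encodek]
      exact Part.mem_some _
  · have := Nat.rfind_spec hc
    simpa [isHeavy] using this

theorem exists_code_heavyArc : ∃ d : Nat.Partrec.Code, d.eval = heavyArc :=
  Nat.Partrec.Code.exists_code.1 (Partrec.nat_iff.1 partrec_heavyArc)

/-- The centres of the balls enumerated with the help of the program `d`: at the stage `t = (s, e)`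
the program is run for `s` steps on the input `e`. -/
def heavyCentre (d : Nat.Partrec.Code) (t : ℕ) : Option ℕ :=
  (d.evaln t.unpair.1 t.unpair.2).map fun c => Nat.pair c (2 ^ (t.unpair.2 + 4) - 1)

/-- The inverses of the radii of the enumerated balls. -/
def heavyInvRadius (t : ℕ) : ℕ := 2 ^ (t.unpair.2 + 3)

theorem computable_heavyCentre (d : Nat.Partrec.Code) : Computable (heavyCentre d) := by
  have s : Primrec fun t : ℕ => t.unpair.1 := Primrec.fst.comp Primrec.unpair
  have e : Primrec fun t : ℕ => t.unpair.2 := Primrec.snd.comp Primrec.unpair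
  have h1 : Primrec fun t : ℕ => d.evaln t.unpair.1 t.unpair.2 :=
    Nat.Partrec.Code.primrec_evaln.comp ((s.pair (Primrec.const d)).pair e)
  have h2 : Primrec₂ fun (t : ℕ) (c : ℕ) => Nat.pair c (2 ^ (t.unpair.2 + 4) - 1) :=
    Primrec₂.natPair.comp Primrec.snd (Primrec.nat_sub.comp (primrec_two_pow.comp
      (Primrec.nat_add.comp (e.comp Primrec.fst) (Primrec.const 4))) (Primrec.const 1))
  exact (Primrec.option_map h1 h2).to_comp

theorem computable_heavyInvRadius : Computable heavyInvRadius :=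
  (primrec_two_pow.comp (Primrec.nat_add.comp (Primrec.snd.comp Primrec.unpair)
    (Primrec.const 3))).to_comp

theorem heavyInvRadius_pos (t : ℕ) : 0 < heavyInvRadius t := Nat.two_pow_pos _

theorem ideal_pair_two_pow (c k : ℕ) : (ComputableMetricSpace.ideal (Nat.pair c (2 ^ k - 1)) :
    UnitAddCircle) = (((c : ℝ) / 2 ^ k : ℝ) : UnitAddCircle) := by
  have h : ((2 ^ k - 1 : ℕ) : ℝ) + 1 = 2 ^ k := by
    have : 2 ^ k - 1 + 1 = 2 ^ k := Nat.sub_add_cancel Nat.one_le_two_pow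
    exact_mod_cast this
  rw [ideal_circle, Nat.unpair_pair]
  simp only
  rw [h]

/-- Each index e contributes at most one ball, however many stages enumerate it, of length at most
2^(-(e+2)). The total is at most 1/2, so the circle is not covered. -/
theorem exists_speed_eq_zero {d : Nat.Partrec.Code} (hd : d.eval = heavyArc) :
    ∃ x, speed (heavyCentre d) heavyInvRadius x = 0 := by
  by_contra! hcon
  set V : ℕ → Set UnitAddCircle := fun e => ⋃ (c : ℕ) (_ : c ∈ heavyArc e),
    Metric.closedBall (((c : ℝ) / 2 ^ (e + 4) : ℝ) : UnitAddCircle) (1 / 2 ^ (e + 3)) with hV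
  have hcover : Set.univ ⊆ ⋃ e, V e := by
    intro x _
    have h1 : ∃ t j, heavyCentre d t = some j ∧
        dist x (ComputableMetricSpace.ideal j) < 1 / (heavyInvRadius t : ℝ) := by
      by_contra! h
      exact hcon x (speed_eq_zero h)
    obtain ⟨t, j, hj, hx⟩ := h1
    obtain ⟨c, hc, rfl⟩ := Option.map_eq_some_iff.1 hj
    refine Set.mem_iUnion.2 ⟨t.unpair.2, Set.mem_iUnion₂.2 ⟨c, ?_, ?_⟩⟩
    · rw [← hd]
      exact Nat.Partrec.Code.evaln_sound hc
    · rw [ideal_pair_two_pow] at hx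
      simp only [heavyInvRadius, Nat.cast_pow, Nat.cast_ofNat] at hx
      exact hx.le
  have hvol : ∀ e, volume (V e) ≤ ENNReal.ofReal (1 / 4 * (1 / 2) ^ e) := by
    intro e
    by_cases hdom : (heavyArc e).Dom
    · have hsub : V e ⊆ Metric.closedBall
          ((((heavyArc e).get hdom : ℝ) / 2 ^ (e + 4) : ℝ) : UnitAddCircle) (1 / 2 ^ (e + 3)) := by
        refine Set.iUnion₂_subset fun c hc => ?_
        rw [Part.get_eq_of_mem hc hdom]
      refine (measure_mono hsub).trans ?_
      rw [AddCircle.volume_closedBall]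
      refine ENNReal.ofReal_le_ofReal ((min_le_right _ _).trans (le_of_eq ?_))
      rw [one_div_pow, pow_add]
      field_simp
      norm_num
    · have hempty : V e = ∅ := by
        refine Set.eq_empty_of_forall_notMem fun x hx => ?_
        obtain ⟨c, hc, -⟩ := Set.mem_iUnion₂.1 hx
        exact hdom (Part.dom_iff_mem.2 ⟨c, hc⟩)
      simp [hempty]
  have hsum : HasSum (fun e : ℕ => (1 / 4 : ℝ) * (1 / 2) ^ e) (1 / 4 * 2) :=
    hasSum_geometric_two.mul_left _
  have h1 : (1 : ℝ≥0∞) ≤ ENNReal.ofReal (1 / 4 * 2) := by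
    calc (1 : ℝ≥0∞) = volume (Set.univ : Set UnitAddCircle) := UnitAddCircle.measure_univ.symm
      _ ≤ volume (⋃ e, V e) := measure_mono hcover
      _ ≤ ∑' e, volume (V e) := measure_iUnion_le _
      _ ≤ ∑' e : ℕ, ENNReal.ofReal (1 / 4 * (1 / 2) ^ e) := ENNReal.tsum_le_tsum hvol
      _ = ENNReal.ofReal (1 / 4 * 2) := by
          rw [← hsum.tsum_eq, ENNReal.ofReal_tsum_of_nonneg (fun e => by positivity) hsum.summable]
  rw [ENNReal.one_le_ofReal] at h1
  norm_num at h1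

/-- If the speed vanished almost everywhere, the tent over the ball chosen for a program of `ν`
would integrate to 0 against `ν`, but to more than the program's precision against its own
approximation. -/
theorem IsComputableMeasure.not_ae_speed_eq_zero {d : Nat.Partrec.Code} (hd : d.eval = heavyArc)
    {ν : ProbabilityMeasure UnitAddCircle} (hν : IsComputableMeasure ν) :
    ¬ ∀ᵐ x ∂(ν : Measure UnitAddCircle), speed (heavyCentre d) heavyInvRadius x = 0 := by
  intro hae
  obtain ⟨f, hf, hfν⟩ := hν
  obtain ⟨e, c, hc, hheavy⟩ := exists_mem_heavyArc hf
  set k := e + 4 with hk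
  have hW := hfν (2 * k + 1)
  set p := f (2 * k + 1)
  set z : UnitAddCircle := (((c : ℝ) / 2 ^ k : ℝ) : UnitAddCircle) with hz
  -- The tent vanishes off the enumerated ball of radius 2·2^(-k) and is at least 2^(-k) on the
  -- concentric ball of half the radius, which contains the heavy arc.
  set φ : UnitAddCircle → ℝ := fun x => max 0 (2 * (1 / 2 ^ k) - dist x z) with hφ
  have hφL : LipschitzWith 1 φ := by
    refine LipschitzWith.of_le_add fun x y => ?_
    have h1 := dist_triangle y x z
    rw [dist_comm y x] at h1
    refine max_le (add_nonneg (le_max_left _ _) dist_nonneg) ?_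
    linarith [le_max_right 0 (2 * (1 / 2 ^ k) - dist y z)]
  have hφ0 : ∀ x, 0 ≤ φ x := fun x => le_max_left _ _
  have hzero : ∫ x, φ x ∂(ν : Measure UnitAddCircle) = 0 := by
    refine integral_eq_zero_of_ae (hae.mono fun x hx => ?_)
    rw [← hd] at hc
    obtain ⟨s, hs⟩ := Nat.Partrec.Code.evaln_complete.1 hc
    have hcen : heavyCentre d (Nat.pair s e) = some (Nat.pair c (2 ^ k - 1)) := by
      rw [heavyCentre, Nat.unpair_pair, Option.mem_def.1 hs]
      rfl
    have h1 : ¬ dist x (ComputableMetricSpace.ideal (Nat.pair c (2 ^ k - 1))) <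
        1 / (heavyInvRadius (Nat.pair s e) : ℝ) := fun h =>
      (speed_pos_of_dist_lt hcen h).ne' hx
    rw [ideal_pair_two_pow, heavyInvRadius, Nat.unpair_pair, not_lt] at h1
    have h2 : (2 : ℝ) * (1 / 2 ^ k) = 1 / ((2 ^ (e + 3) : ℕ) : ℝ) := by
      rw [hk, pow_succ]
      push_cast
      field_simp
    exact max_eq_left (by rw [h2]; linarith)
  have hlow : (1 / 2 ^ k : ℝ) * (1 / 2 ^ k) ≤
      ∫ x, φ x ∂(idealMeasure UnitAddCircle p : Measure UnitAddCircle) := by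
    have h1 := mul_meas_ge_le_integral_of_nonneg (Eventually.of_forall hφ0)
      (integrable_of_lipschitzWith hφL (idealMeasure UnitAddCircle p : Measure UnitAddCircle))
      (1 / 2 ^ k)
    refine le_trans (mul_le_mul_of_nonneg_left ?_ (by positivity)) h1
    refine (le_idealMeasure_closedBall_of_heavy hheavy).trans (measureReal_mono fun x hx => ?_)
    have hx' : dist x z ≤ 1 / 2 ^ k := hx
    have h2 : 2 * (1 / 2 ^ k : ℝ) = 1 / 2 ^ k + 1 / 2 ^ k := two_mul _
    show 1 / 2 ^ k ≤ max 0 (2 * (1 / 2 ^ k) - dist x z)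
    exact le_max_of_le_right (by rw [h2]; linarith)
  have h1 := (abs_integral_sub_integral_le_wassersteinDist _ _ hφL).trans_lt hW
  rw [hzero, sub_zero] at h1
  have h2 := (le_abs_self _).trans_lt h1
  -- The queried precision is exactly half the lower bound 2^(-2k) for the integral.
  have h3 : (2 : ℝ)⁻¹ ^ (2 * k + 1) = 1 / 2 * ((1 / 2 ^ k) * (1 / 2 ^ k)) := by
    rw [pow_succ, two_mul, pow_add, inv_pow]
    ring
  have h4 : (0 : ℝ) < (1 / 2 ^ k) * (1 / 2 ^ k) := by positivity
  rw [h3] at h2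
  linarith

/-! ### The theorem -/

theorem isInvariantProbability_map_fst {S R : UnitAddCircle → UnitAddCircle} (hS : Measurable S)
    {μ : Measure (UnitAddCircle × UnitAddCircle)}
    (hμ : IsInvariantProbability (Prod.map S R) μ) : IsInvariantProbability S (μ.map Prod.fst) := by
  obtain ⟨hprob, hinv⟩ := hμ
  refine ⟨Measure.isProbabilityMeasure_map measurable_fst.aemeasurable, hS, ?_⟩
  rw [Measure.map_map hS measurable_fst]
  conv_rhs => rw [← hinv.map_eq, Measure.map_map measurable_fst hinv.measurable]
  rfl

theorem mainTheorem5 :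
    ∃ (T₁ : UnitAddCircle → UnitAddCircle) (K : Set UnitAddCircle)
      (T : UnitAddCircle × UnitAddCircle → UnitAddCircle × UnitAddCircle),
      -- the circle map `T₁`, all of whose invariant measures live on `K`
      IsComputableMap T₁ ∧
      IsClosed K ∧
      (∀ x ∈ K, ¬ IsComputablePoint x) ∧
      (∀ ν : ProbabilityMeasure UnitAddCircle, IsInvariantProbability T₁ (ν : Measure UnitAddCircle) →
        (ν : Measure UnitAddCircle).support ⊆ K ∧ ¬ IsComputableMeasure ν) ∧
      -- the torus map `T = T₁ × T₂`
      T = Prod.map T₁ doublingMap ∧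
      IsComputableMap T ∧
      topologicalEntropy T = (Real.log 2 : EReal) ∧
      (∃ μ : ProbabilityMeasure (UnitAddCircle × UnitAddCircle),
        IsMeasureOfMaximalEntropy T (μ : Measure (UnitAddCircle × UnitAddCircle))) ∧
      (∀ ν : ProbabilityMeasure UnitAddCircle, IsInvariantProbability T₁ (ν : Measure UnitAddCircle) →
        IsMeasureOfMaximalEntropy T ((ν : Measure UnitAddCircle).prod volume)) ∧
      (∀ μ : ProbabilityMeasure (UnitAddCircle × UnitAddCircle),
        IsInvariantProbability T (μ : Measure (UnitAddCircle × UnitAddCircle)) →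
          ¬ IsComputableMeasure μ) ∧
      (∀ μ : ProbabilityMeasure (UnitAddCircle × UnitAddCircle),
        IsMeasureOfMaximalEntropy T (μ : Measure (UnitAddCircle × UnitAddCircle)) →
          ¬ IsComputableMeasure μ) := by
  have hvol := UnitAddCircle.isProbabilityMeasure_volume
  obtain ⟨d, hd⟩ := exists_code_heavyArc
  set g := speed (heavyCentre d) heavyInvRadius with hg
  obtain ⟨x₀, hx₀⟩ := exists_speed_eq_zero hd
  -- The circle is cut at a rest point, which need only exist.
  have hdrift : IsDriftBefore g (circleCoord 0 x₀) :=
    isDriftBefore_speed (by rw [coe_circleCoord]; exact hx₀)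
  have hL : LipschitzWith 2 (driftMap g) := lipschitzWith_driftMap_speed
  have hmeas : Measurable (driftMap g) := hL.continuous.measurable
  have hideal : ComputableOnIdeal (driftMap g) := computableOnIdeal_driftMap_speed
    (computable_heavyCentre d) computable_heavyInvRadius heavyInvRadius_pos
  have hclosed : IsClosed {x | g x = 0} := isClosed_eq continuous_speed continuous_const
  have hinv₁ : ∀ ν : ProbabilityMeasure UnitAddCircle,
      IsInvariantProbability (driftMap g) (ν : Measure UnitAddCircle) →
        (ν : Measure UnitAddCircle).support ⊆ {x | g x = 0} ∧ ¬ IsComputableMeasure ν :=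
    fun ν hν =>
      have hae := ae_eq_zero_of_invariant_driftMap hdrift hν
      ⟨Measure.support_subset_of_isClosed hclosed hae, fun h => h.not_ae_speed_eq_zero hd hae⟩
  have htop : topologicalEntropy (Prod.map (driftMap g) doublingMap) = (Real.log 2 : EReal) :=
    le_antisymm (topologicalEntropy_le_log two_pos (itineraryGrowthLE_driftMap_prod hdrift))
      (log_two_le_topologicalEntropy_prod _)
  have hmax : ∀ ν : ProbabilityMeasure UnitAddCircle,
      IsInvariantProbability (driftMap g) (ν : Measure UnitAddCircle) →
        IsMeasureOfMaximalEntropy (Prod.map (driftMap g) doublingMap)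
          ((ν : Measure UnitAddCircle).prod volume) := by
    intro ν hν
    have hprod : IsInvariantProbability (Prod.map (driftMap g) doublingMap)
        ((ν : Measure UnitAddCircle).prod volume) :=
      ⟨inferInstance, hν.2.prod measurePreserving_doublingMap⟩
    refine ⟨hprod, htop ▸ le_antisymm ?_ (log_two_le_measureEntropy_prod hmeas _)⟩
    exact measureEntropy_le_log two_pos (itineraryGrowthLE_driftMap_prod hdrift) hprod
  -- Rest points are fixed. This supplies an invariant measure for the existence claim and, at a
  -- computable point of K, would supply a computable one.
  have hdirac : ∀ x, g x = 0 → IsInvariantProbability (driftMap g) (Measure.dirac x) := by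
    intro x hx
    refine ⟨inferInstance, hmeas, ?_⟩
    rw [Measure.map_dirac' hmeas, driftMap, hx]
    simp
  have hnoncomp : ∀ μ : ProbabilityMeasure (UnitAddCircle × UnitAddCircle),
      IsInvariantProbability (Prod.map (driftMap g) doublingMap)
        (μ : Measure (UnitAddCircle × UnitAddCircle)) → ¬ IsComputableMeasure μ := by
    intro μ hμ hcomp
    have hfst := isInvariantProbability_map_fst hmeas hμ
    exact (hinv₁ ⟨_, hfst.1⟩ hfst).2 (hcomp.map_fst rfl)
  refine ⟨driftMap g, {x | g x = 0}, Prod.map (driftMap g) doublingMap,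
    hideal.isComputableMap hL, hclosed, fun x hx hcomp => ?_, hinv₁, rfl, ?_, htop,
    ⟨⟨(Measure.dirac x₀).prod volume, inferInstance⟩,
      hmax ⟨Measure.dirac x₀, inferInstance⟩ (hdirac x₀ hx₀)⟩, hmax, hnoncomp,
    fun μ hμ => hnoncomp μ hμ.1⟩
  · exact (hinv₁ ⟨Measure.dirac x, inferInstance⟩ (hdirac x hx)).2
      (hcomp.isComputableMeasure_dirac rfl)
  · refine (hideal.prodMap computableOnIdeal_doublingMap).isComputableMap ?_
    have h := (hL.comp LipschitzWith.prod_fst).prodMk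
      (lipschitzWith_doublingMap.comp LipschitzWith.prod_snd)
    rwa [mul_one, max_self] at h
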